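/- Let $i\ge 0$ be an integer and let $L$ be an even lattice, i.e. a finitely generated free abelian group with a nondegenerate symmetric bilinear form $(\cdot,\cdot)$ with values in $\mathbb{Z}$ such that $(x,x)\in 2\mathbb{Z}$ for all $x\in L$. Suppose that $L$ has signature $(1,17)$ and discriminant (determinant of a Gram matrix) $-4^i$. Then there is an even unimodular lattice $M$ that contains $L$ as a sublattice of finite index (equivalently, of the same rank). Moreover, every even unimodular lattice $M$ that contains $L$ as a sublattice of finite index is isometric to $II_{1,17}=U\oplus E_8^{\oplus 2}$, where $U$ is the hyperbolic plane, with Gram matrix $\begin{pmatrix}0&1\\1&0\end{pmatrix}$, and $E_8$ is the negative definite $E_8$ root lattice. -/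

import Mathlib

universe u v w

/-- An (integral) lattice: a finitely generated free `ℤ`-module with a nondegenerate symmetric
`ℤ`-valued bilinear form. -/
structure IntLattice where
  carrier : Type u
  [addCommGroup : AddCommGroup carrier]
  [free : Module.Free ℤ carrier]
  [finite : Module.Finite ℤ carrier]
  form : LinearMap.BilinForm ℤ carrier
  isSymm : form.IsSymm
  nondegenerate : form.Nondegenerate

attribute [instance] IntLattice.addCommGroup IntLattice.free IntLattice.finite

namespace IntLattice

/-- The discriminant of a lattice: the determinant of a Gram matrix. It does not depend on the
basis, see `disc_eq`. -/
noncomputable def disc (L : IntLattice.{u}) : ℤ :=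
  (LinearMap.BilinForm.toMatrix (Module.Free.chooseBasis ℤ L.carrier) L.form).det

theorem disc_eq (L : IntLattice.{u}) {ι : Type w} [Fintype ι] [DecidableEq ι]
    (b : Module.Basis ι ℤ L.carrier) :
    L.disc = (LinearMap.BilinForm.toMatrix b L.form).det := by
  classical
  let c := Module.Free.chooseBasis ℤ L.carrier
  let e := c.indexEquiv b
  have h1 : L.disc = (LinearMap.BilinForm.toMatrix (c.reindex e) L.form).det := by
    have : LinearMap.BilinForm.toMatrix (c.reindex e) L.form
        = (LinearMap.BilinForm.toMatrix c L.form).submatrix e.symm e.symm := by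
      ext i j
      simp [LinearMap.BilinForm.toMatrix_apply]
    rw [this, Matrix.det_submatrix_equiv_self]
    rfl
  have h2 := LinearMap.BilinForm.toMatrix_mul_basis_toMatrix (c.reindex e) b L.form
  have h3 : IsUnit ((c.reindex e).toMatrix b).det := by
    rw [← Matrix.isUnit_iff_isUnit_det]
    exact IsUnit.of_mul_eq_one _ ((c.reindex e).toMatrix_mul_toMatrix_flip b)
  rw [h1, ← h2, Matrix.det_mul, Matrix.det_mul, Matrix.det_transpose]
  rcases Int.isUnit_iff.mp h3 with h | h <;> rw [h] <;> ring

/-- `(x, x)` is even for every `x`. -/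
def IsEven (L : IntLattice.{u}) : Prop := ∀ x : L.carrier, Even (L.form x x)

/-- The discriminant is `1` or `-1`. -/
def IsUnimodular (L : IntLattice.{u}) : Prop := IsUnit L.disc

/-- The real quadratic form `x ↦ (x, x)` on `ℝ ⊗ L`. -/
noncomputable def realForm (L : IntLattice.{u}) :
    QuadraticForm ℝ (TensorProduct ℤ ℝ L.carrier) :=
  (LinearMap.BilinForm.baseChange ℝ L.form).toQuadraticMap

/-- The lattice has signature `(p, q)`. As the form is nondegenerate, its rank is then `p + q`. -/
def HasSignature (L : IntLattice.{u}) (p q : ℕ) : Prop :=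
  sigPos L.realForm = p ∧ sigNeg L.realForm = q

/-- Two lattices are isometric. -/
def Isometric (L : IntLattice.{u}) (M : IntLattice.{v}) : Prop :=
  L.form.Equivalent M.form

/-- `f` identifies `L` with a subgroup of finite index of `M` and the form of `L` with the
restriction of the form of `M`, i.e. it presents `M` as an overlattice of `L` (of the same rank). -/
structure IsOverlattice (L : IntLattice.{u}) (M : IntLattice.{v})
    (f : L.carrier →ₗ[ℤ] M.carrier) : Prop where
  injective : Function.Injective f
  map_form : ∀ x y, M.form (f x) (f y) = L.form x y
  finite_quotient : Finite (M.carrier ⧸ LinearMap.range f)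

/-- The lattice `ℤ^ι` with Gram matrix `A`. -/
noncomputable def ofGram {ι : Type w} [Fintype ι] [DecidableEq ι] (A : Matrix ι ι ℤ)
    (hA : A.IsSymm) (hdet : A.det ≠ 0) : IntLattice.{w} where
  carrier := ι → ℤ
  form := Matrix.toBilin' A
  isSymm := by
    refine ⟨fun x y => ?_⟩
    simp only [Matrix.toBilin'_apply']
    rw [Matrix.dotProduct_mulVec, ← Matrix.mulVec_transpose, hA.eq, dotProduct_comm]
  nondegenerate := LinearMap.BilinForm.nondegenerate_toBilin'_of_det_ne_zero' A hdet

/-- The orthogonal direct sum of two lattices. -/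
noncomputable def directSum (L : IntLattice.{u}) (M : IntLattice.{v}) :
    IntLattice.{max u v} where
  carrier := L.carrier × M.carrier
  form := L.form.compl₁₂ (LinearMap.fst ℤ _ _) (LinearMap.fst ℤ _ _) +
    M.form.compl₁₂ (LinearMap.snd ℤ _ _) (LinearMap.snd ℤ _ _)
  isSymm := by
    refine ⟨fun x y => ?_⟩
    have h1 := L.isSymm.eq x.1 y.1
    have h2 := M.isSymm.eq x.2 y.2
    simp [h1, h2]
  nondegenerate := by
    refine ⟨fun x hx => ?_, fun y hy => ?_⟩
    · refine Prod.ext (L.nondegenerate.1 _ fun y => ?_) (M.nondegenerate.1 _ fun y => ?_)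
      · simpa using hx (y, 0)
      · simpa using hx (0, y)
    · refine Prod.ext (L.nondegenerate.2 _ fun x => ?_) (M.nondegenerate.2 _ fun x => ?_)
      · simpa using hy (x, 0)
      · simpa using hy (0, x)

/-- The hyperbolic plane `U`. -/
noncomputable def U : IntLattice.{0} :=
  ofGram !![0, 1; 1, 0] (by decide) (by decide)

/-- The `E₈` root lattice, with the negative definite sign convention. -/
noncomputable def E8 : IntLattice.{0} :=
  ofGram (-CartanMatrix.E₈) CartanMatrix.E₈_isSymm.neg
    (by rw [Matrix.det_neg, CartanMatrix.E₈_det]; decide)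

/-- The lattice `II_{1,17} = U ⊕ E₈ ⊕ E₈`. -/
noncomputable def II_1_17 : IntLattice.{0} := directSum U (directSum E8 E8)

end IntLattice

/-!
The argument avoids the Hasse–Minkowski theorem, the classification of definite lattices and the
signature formula for discriminant forms.

**Rational form.** A lattice `L` of rank at most `18` whose discriminant is a power of `2` up to sign
represents a power of `2` up to sign (`exists_value_natAbs_eq_two_pow`). Indeed, as long as the
discriminant group has order at least `4` it contains an isotropic element of order `2`, so that,
passing to overlattices, one may assume that the discriminant is `±1` or `±2`; the sublattice of
vectors of even norm then has discriminant at most `8`. Minkowski's theorem, applied to the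
positive definite form obtained by taking absolute values of the eigenvalues, gives a nonzero vector
whose norm has absolute value less than `6` (`exists_abs_value_lt_six`). The norm being even,
it is `0`, `±2` or `±4`, and an isotropic vector produces a vector whose norm is a power of `4`.
Splitting off such vectors one after the other diagonalizes the form over `ℚ` with entries `±1` and
`±2`, and `⟨±2⟩ ⊕ ⟨±2⟩` is rationally `⟨±1⟩ ⊕ ⟨±1⟩`. If the discriminant is `±4 ^ k`, no `±2` is left
over, hence the form is rationally `⟨1⟩ᵖ ⊕ ⟨-1⟩^q` (`exists_orthogonal_frame`).

**Existence.** For signature `(1, 17)` the rational space of `L` thus contains an even unimodular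
lattice `N`, of type `Dₙ⁺`. The lattice `L + (L* ∩ N)` is even, and its dual is
`L* ∩ (L + N) = L + (L* ∩ N)`, so it is unimodular (`exists_even_unimodular_overlattice`).

**Uniqueness.** By the rational result, unimodular lattices of signature `(1, n)` with
`1 ≤ n ≤ 17` are isotropic. It follows by induction on `n` that the odd ones have an orthonormal
basis (`exists_orthonormal_of_odd`), and that an even one is `U ⊕ N`. If `U ⊕ N₁` and `U ⊕ N₂` are
two even ones, then `⟨1⟩ ⊕ ⟨-1⟩ ⊕ N₁` and `⟨1⟩ ⊕ ⟨-1⟩ ⊕ N₂` are isometric, being odd. The sublattice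
of vectors of even norm of `⟨1⟩ ⊕ ⟨-1⟩ ⊕ N` has exactly two even unimodular overlattices, which are
exchanged by a reflection, and one of them is `U ⊕ N`; therefore `U ⊕ N₁` and `U ⊕ N₂` are isometric
(`equivalent_of_even_unimodular`).
-/

open Matrix MeasureTheory

namespace IntForm

/-! ### Minkowski's theorem for indefinite forms -/

/-- A real symmetric matrix `A` is dominated by a positive definite form `x ↦ ‖T x‖²` of
discriminant `|det A|`: take the absolute values of the eigenvalues. -/
theorem exists_majorant {m : ℕ} (A : Matrix (Fin m) (Fin m) ℝ) (hA : A.IsHermitian) :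
    ∃ T : Matrix (Fin m) (Fin m) ℝ, T.det ^ 2 = |A.det| ∧
      ∀ x : Fin m → ℝ, |x ⬝ᵥ A *ᵥ x| ≤ ∑ i, (T *ᵥ x) i ^ 2 := by
  set V : Matrix (Fin m) (Fin m) ℝ := (hA.eigenvectorUnitary : Matrix (Fin m) (Fin m) ℝ) with hV
  set ev := hA.eigenvalues
  have hVV : Vᵀ * V = 1 := by
    have := Unitary.coe_star_mul_self hA.eigenvectorUnitary
    simpa [star_eq_conjTranspose, conjTranspose_eq_transpose_of_trivial] using this
  have hspec : A = V * diagonal ev * Vᵀ := by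
    have := hA.spectral_theorem
    rw [Unitary.conjStarAlgAut_apply] at this
    simpa [star_eq_conjTranspose, conjTranspose_eq_transpose_of_trivial, hV, ev] using this
  refine ⟨diagonal (fun i => √|ev i|) * Vᵀ, ?_, fun x => ?_⟩
  · have h1 : V.det * V.det = 1 := by
      have := congrArg det hVV
      simpa using this
    rw [hA.det_eq_prod_eigenvalues, det_mul, det_diagonal, det_transpose, mul_pow,
      show V.det ^ 2 = 1 by rw [sq, h1], mul_one, ← Finset.prod_pow]
    simp [Finset.abs_prod, ev]
  · have h1 : x ⬝ᵥ A *ᵥ x = ∑ i, ev i * (Vᵀ *ᵥ x) i ^ 2 := by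
      conv_lhs => rw [hspec]
      rw [← mulVec_mulVec, ← mulVec_mulVec, dotProduct_mulVec, ← mulVec_transpose]
      simp only [dotProduct, mulVec_diagonal]
      exact Finset.sum_congr rfl fun i _ => by ring
    rw [h1]
    refine (Finset.abs_sum_le_sum_abs _ _).trans_eq (Finset.sum_congr rfl fun i _ => ?_)
    rw [← mulVec_mulVec, mulVec_diagonal, mul_pow, Real.sq_sqrt (abs_nonneg _), abs_mul,
      abs_sq]

/-- The ball of squared radius `6` is large enough for Minkowski's theorem to apply to a lattice
of discriminant at most `8` in every dimension from `2` to `18`. -/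
theorem two_pow_mul_lt_volume_ball {m : ℕ} (h2 : 2 ≤ m) (h18 : m ≤ 18) :
    ENNReal.ofReal (2 ^ m * √8) < volume {x : Fin m → ℝ | ∑ i, x i ^ 2 < 6} := by
  have hvol : volume {x : Fin m → ℝ | ∑ i, x i ^ 2 < 6} =
      volume (Metric.ball (0 : EuclideanSpace ℝ (Fin m)) √6) := by
    rw [← (EuclideanSpace.volume_preserving_symm_measurableEquiv_toLp (Fin m)).measure_preimage_equiv]
    congr 1
    ext x
    simp only [Set.mem_preimage, Set.mem_ofPred_eq, Metric.mem_ball, dist_zero_right,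
      EuclideanSpace.norm_eq, Real.norm_eq_abs, sq_abs]
    rw [Real.sqrt_lt_sqrt_iff (Finset.sum_nonneg fun i _ => sq_nonneg _)]
    rfl
  have : Nonempty (Fin m) := ⟨⟨0, by omega⟩⟩
  have hpi := Real.pi_gt_d2
  have h8 : √8 = 2 * √2 := by
    rw [show (8 : ℝ) = 2 ^ 2 * 2 by norm_num, Real.sqrt_mul (by norm_num),
      Real.sqrt_sq (by norm_num)]
  have h6 : √6 = √3 * √2 := by
    rw [← Real.sqrt_mul (by norm_num)]; norm_num
  have hs2 : √2 < 1.4143 := by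
    rw [Real.sqrt_lt' (by norm_num)]; norm_num
  have hs2' : 0 < √2 := by positivity
  have hs3 : 1.732 < √3 := by
    apply Real.lt_sqrt_of_sq_lt; norm_num
  rw [hvol]
  obtain ⟨k, hk | hk⟩ := Nat.even_or_odd' m
  · rw [InnerProductSpace.volume_ball_of_dim_even (k := k) (by simpa using hk),
      finrank_euclideanSpace_fin, ← ENNReal.ofReal_pow (by positivity),
      ← ENNReal.ofReal_mul (by positivity), ENNReal.ofReal_lt_ofReal_iff (by positivity)]
    subst hk
    rw [pow_mul √6, Real.sq_sqrt (by norm_num), h8]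
    have hp : (3.14 : ℝ) ^ k ≤ Real.pi ^ k := pow_le_pow_left₀ (by norm_num) hpi.le k
    have hk : 1 ≤ k ∧ k ≤ 9 := by omega
    have : (6 : ℝ) ^ k * (3.14 ^ k / k.factorial) ≤ 6 ^ k * (Real.pi ^ k / k.factorial) := by
      gcongr
    refine lt_of_lt_of_le ?_ this
    have : (2 : ℝ) ^ (2 * k) * (2 * √2) < 2 ^ (2 * k) * (2 * 1.4143) := by gcongr
    refine this.trans ?_
    obtain ⟨h1, h9⟩ := hk
    clear * - h1 h9
    interval_cases k <;> norm_num [Nat.factorial]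
  · rw [InnerProductSpace.volume_ball_of_dim_odd (k := k) (by simpa using hk),
      finrank_euclideanSpace_fin, ← ENNReal.ofReal_pow (by positivity),
      ← ENNReal.ofReal_mul (by positivity), ENNReal.ofReal_lt_ofReal_iff (by positivity)]
    subst hk
    rw [pow_succ √6, pow_mul √6, Real.sq_sqrt (by norm_num), h8, h6]
    have hp : (3.14 : ℝ) ^ k ≤ Real.pi ^ k := pow_le_pow_left₀ (by norm_num) hpi.le k
    have hk : 1 ≤ k ∧ k ≤ 8 := by omega
    obtain ⟨h1, h9⟩ := hk
    have h3 : (6 : ℝ) ^ k * (1.732 * √2) * (3.14 ^ k * 2 ^ (k + 1) / (2 * k + 1).doubleFactorial)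
        ≤ 6 ^ k * (√3 * √2) * (Real.pi ^ k * 2 ^ (k + 1) / (2 * k + 1).doubleFactorial) := by
      gcongr
    refine lt_of_lt_of_le ?_ h3
    have h4 : (2 : ℝ) ^ (2 * k + 1) * 2 <
        6 ^ k * 1.732 * (3.14 ^ k * 2 ^ (k + 1) / (2 * k + 1).doubleFactorial) := by
      clear * - h1 h9
      interval_cases k <;> norm_num [Nat.doubleFactorial]
    calc _ = ((2 : ℝ) ^ (2 * k + 1) * 2) * √2 := by ring
      _ < _ := mul_lt_mul_of_pos_right h4 hs2'
      _ = _ := by ring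

/-- Minkowski's theorem for an integral quadratic form of discriminant at most `8`, definite or
not. -/
theorem exists_abs_value_lt_six {m : ℕ} (h2 : 2 ≤ m) (h18 : m ≤ 18)
    (G : Matrix (Fin m) (Fin m) ℤ) (hG : G.IsSymm) (h0 : G.det ≠ 0) (h8 : |G.det| ≤ 8) :
    ∃ x : Fin m → ℤ, x ≠ 0 ∧ |x ⬝ᵥ G *ᵥ x| < 6 := by
  set A : Matrix (Fin m) (Fin m) ℝ := G.map (Int.cast : ℤ → ℝ) with hAdef
  have hA : A.IsHermitian := by
    ext i j
    simp [A, hG.apply i j]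
  have hdetA : A.det = (G.det : ℝ) := by
    exact ((Int.castRingHom ℝ).map_det G).symm
  obtain ⟨T, hT, hTx⟩ := exists_majorant A hA
  have hdetT : T.det ≠ 0 := by
    intro h
    rw [h, hdetA] at hT
    exact h0 (by simpa using hT.symm)
  have hle : |T.det| ≤ √8 := by
    apply Real.abs_le_sqrt
    rw [hT, hdetA]
    exact_mod_cast h8
  let s : Set (Fin m → ℝ) := T.toLin' ⁻¹' {x | ∑ i, x i ^ 2 < 6}
  have hball : Convex ℝ {x : Fin m → ℝ | ∑ i, x i ^ 2 < 6} := by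
    intro x hx y hy a b ha hb hab
    simp only [Set.mem_ofPred_eq, Pi.add_apply, Pi.smul_apply, smul_eq_mul] at *
    have hle : ∑ i, (a * x i + b * y i) ^ 2 ≤ a * ∑ i, x i ^ 2 + b * ∑ i, y i ^ 2 := by
      rw [Finset.mul_sum, Finset.mul_sum, ← Finset.sum_add_distrib]
      refine Finset.sum_le_sum fun i _ => ?_
      obtain rfl : b = 1 - a := by linarith
      nlinarith [mul_nonneg (mul_nonneg ha hb) (sq_nonneg (x i - y i))]
    exact hle.trans_lt (convex_Iio (𝕜 := ℝ) (6 : ℝ) hx hy ha hb hab)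
  have hs : volume s = ENNReal.ofReal |T.det⁻¹| * volume {x : Fin m → ℝ | ∑ i, x i ^ 2 < 6} := by
    have := Measure.addHaar_preimage_linearMap (volume : Measure (Fin m → ℝ)) (f := T.toLin')
      (by rwa [LinearMap.det_toLin']) {x : Fin m → ℝ | ∑ i, x i ^ 2 < 6}
    rwa [LinearMap.det_toLin'] at this
  have hfund := ZSpan.isAddFundamentalDomain' (Pi.basisFun ℝ (Fin m)) volume
  have hcount : Countable (Submodule.span ℤ (Set.range (Pi.basisFun ℝ (Fin m)))).toAddSubgroup :=
    inferInstanceAs (Countable (Submodule.span ℤ (Set.range (Pi.basisFun ℝ (Fin m)))))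
  have hlt : volume (ZSpan.fundamentalDomain (Pi.basisFun ℝ (Fin m))) *
      2 ^ Module.finrank ℝ (Fin m → ℝ) < volume s := by
    have h1 := two_pow_mul_lt_volume_ball h2 h18
    have h2 : volume (ZSpan.fundamentalDomain (Pi.basisFun ℝ (Fin m))) = 1 := by
      rw [ZSpan.fundamentalDomain_pi_basisFun, volume_pi, Measure.pi_pi]
      simp
    rw [h2, one_mul, hs, Module.finrank_fin_fun]
    have hpos : 0 < |T.det| := abs_pos.mpr hdetT
    have h3 : ENNReal.ofReal |T.det⁻¹| * ENNReal.ofReal (2 ^ m * √8) <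
        ENNReal.ofReal |T.det⁻¹| * volume {x : Fin m → ℝ | ∑ i, x i ^ 2 < 6} := by
      refine ENNReal.mul_lt_mul_right ?_ ENNReal.ofReal_ne_top h1
      simpa using hdetT
    refine lt_of_le_of_lt ?_ h3
    rw [← ENNReal.ofReal_mul (abs_nonneg _), show (2 : ENNReal) ^ m = ENNReal.ofReal (2 ^ m) by
      rw [ENNReal.ofReal_pow (by norm_num)]; simp]
    apply ENNReal.ofReal_le_ofReal
    rw [abs_inv, inv_mul_eq_div, le_div_iff₀ hpos]
    gcongr
  obtain ⟨x, hx0, hxs⟩ := exists_ne_zero_mem_lattice_of_measure_mul_two_pow_lt_measure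
    hfund (s := s) (fun x hx => by simpa [s, mulVec_neg] using hx) (hball.linear_preimage _) hlt
  have hx := ((Pi.basisFun ℝ (Fin m)).mem_span_iff_repr_mem ℤ _).mp x.2
  choose z hz using hx
  have hz' : (x : Fin m → ℝ) = fun i => (z i : ℝ) := by
    ext i
    have := hz i
    simpa using this.symm
  refine ⟨z, ?_, ?_⟩
  · rintro rfl
    apply hx0
    ext i
    simp [hz']
  · have h1 := (hTx x).trans_lt hxs
    have h2 : (x : Fin m → ℝ) ⬝ᵥ A *ᵥ x = ((z ⬝ᵥ G *ᵥ z : ℤ) : ℝ) := by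
      rw [hz']
      simp [dotProduct, mulVec, A]
    rw [h2] at h1
    exact_mod_cast h1

/-! ### Forms whose discriminant is a power of `2` -/

theorem dotProduct_mulVec_comm {m : ℕ} {G : Matrix (Fin m) (Fin m) ℤ} (hG : G.IsSymm)
    (x y : Fin m → ℤ) : x ⬝ᵥ G *ᵥ y = y ⬝ᵥ G *ᵥ x := by
  rw [dotProduct_mulVec, ← mulVec_transpose, hG.eq, dotProduct_comm]

theorem dotProduct_congr_mulVec {m : ℕ} (G P : Matrix (Fin m) (Fin m) ℤ) (x y : Fin m → ℤ) :
    x ⬝ᵥ (Pᵀ * G * P) *ᵥ y = (P *ᵥ x) ⬝ᵥ G *ᵥ (P *ᵥ y) := by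
  rw [← mulVec_mulVec, ← mulVec_mulVec, dotProduct_mulVec, vecMul_transpose]

theorem card_quotient_range_mulVecLin {m : ℕ} (G : Matrix (Fin m) (Fin m) ℤ) (h0 : G.det ≠ 0) :
    Nat.card ((Fin m → ℤ) ⧸ LinearMap.range G.mulVecLin) = G.det.natAbs := by
  have hinj : Function.Injective G.mulVecLin := mulVec_injective_of_det_ne_zero h0
  have := Submodule.natAbs_det_equiv (LinearMap.range G.mulVecLin)
    (LinearEquiv.ofInjective G.mulVecLin hinj)
  rw [← this, ← LinearMap.det_toLin' G]
  congr 2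

/-- If the discriminant group `ℤᵐ / G ℤᵐ` is a `2`-group of order at least `4`, it has a nonzero
element of order `2` which is isotropic for the discriminant bilinear form: if there is an element
`a` of order `4`, then `2 a` is one; otherwise the form takes values `0` or `1 / 2` on the diagonal,
additively, so that it vanishes on one of `a`, `b`, `a - b`. -/
theorem exists_isotropic_mem_discriminant {m k : ℕ} {G : Matrix (Fin m) (Fin m) ℤ}
    (hG : G.IsSymm) (hk : 2 ≤ k) (hdet : G.det.natAbs = 2 ^ k) :
    ∃ φ w : Fin m → ℤ, G *ᵥ w = 2 • φ ∧ (∀ u, G *ᵥ u ≠ φ) ∧ Even (φ ⬝ᵥ w) := by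
  have h0 : G.det ≠ 0 := by
    intro h
    rw [h] at hdet
    exact absurd hdet.symm (by simp)
  set R := LinearMap.range G.mulVecLin with hR
  have hcard : Nat.card ((Fin m → ℤ) ⧸ R) = 2 ^ k := by
    rw [hR, card_quotient_range_mulVecLin G h0, hdet]
  have : Finite ((Fin m → ℤ) ⧸ R) := Nat.finite_of_card_ne_zero (by rw [hcard]; positivity)
  have hmem : ∀ φ : Fin m → ℤ, R.mkQ φ = 0 ↔ ∃ u, G *ᵥ u = φ := fun φ => by
    rw [Submodule.mkQ_apply, Submodule.Quotient.mk_eq_zero, hR, LinearMap.mem_range]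
    rfl
  by_cases hA : ∃ a : (Fin m → ℤ) ⧸ R, 2 • a ≠ 0
  · obtain ⟨a, ha⟩ := hA
    obtain ⟨j, -, hj⟩ := (Nat.dvd_prime_pow Nat.prime_two).mp (hcard ▸ addOrderOf_dvd_natCard a)
    have hj2 : 2 ≤ j := by
      by_contra h
      apply ha
      rw [← addOrderOf_dvd_iff_nsmul_eq_zero, hj]
      exact pow_dvd_pow 2 (show j ≤ 1 by omega)
    obtain ⟨α, hα⟩ := R.mkQ_surjective ((2 ^ (j - 2)) • a)
    have h4 : R.mkQ (4 • α) = 0 := by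
      rw [map_nsmul, hα, ← mul_nsmul', ← addOrderOf_dvd_iff_nsmul_eq_zero, hj,
        show (4 : ℕ) = 2 ^ 2 by norm_num, ← pow_add]
      exact pow_dvd_pow 2 (by omega)
    obtain ⟨w, hw⟩ := (hmem _).mp h4
    refine ⟨2 • α, w, by rw [hw, ← mul_nsmul'], fun u hu => ?_, ?_⟩
    · have h2 : R.mkQ (2 • α) = 0 := (hmem _).mpr ⟨u, hu⟩
      rw [map_nsmul, hα, ← mul_nsmul', ← addOrderOf_dvd_iff_nsmul_eq_zero, hj, ← pow_succ',
        Nat.pow_dvd_pow_iff_le_right (by norm_num)] at h2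
      omega
    · rw [smul_dotProduct, two_nsmul]
      exact Even.add_self _
  · push Not at hA
    have : Nontrivial ((Fin m → ℤ) ⧸ R) := by
      rw [← Finite.one_lt_card_iff_nontrivial, hcard]
      exact Nat.one_lt_two_pow (by omega)
    obtain ⟨a, ha⟩ := exists_ne (0 : (Fin m → ℤ) ⧸ R)
    obtain ⟨b, hb⟩ : ∃ b, b ∉ ({0, a} : Set ((Fin m → ℤ) ⧸ R)) := by
      by_contra h
      push Not at h
      have h1 : ({0, a} : Set ((Fin m → ℤ) ⧸ R)) = Set.univ := Set.eq_univ_of_forall h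
      have h2 := Set.ncard_univ ((Fin m → ℤ) ⧸ R)
      rw [← h1, hcard] at h2
      have h3 := Set.ncard_insert_le (0 : (Fin m → ℤ) ⧸ R) {a}
      rw [h2, Set.ncard_singleton] at h3
      have := Nat.pow_le_pow_right (show 0 < 2 by norm_num) hk
      omega
    simp only [Set.mem_insert_iff, Set.mem_singleton_iff, not_or] at hb
    obtain ⟨α, rfl⟩ := R.mkQ_surjective a
    obtain ⟨β, rfl⟩ := R.mkQ_surjective b
    obtain ⟨u, hu⟩ := (hmem (2 • α)).mp (by rw [map_nsmul, hA])
    obtain ⟨v, hv⟩ := (hmem (2 • β)).mp (by rw [map_nsmul, hA])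
    have hsymm : α ⬝ᵥ v = β ⬝ᵥ u := by
      have := dotProduct_mulVec_comm hG v u
      rw [hu, hv, dotProduct_smul, dotProduct_smul, dotProduct_comm v, dotProduct_comm u] at this
      simpa using this
    by_cases h1 : Even (α ⬝ᵥ u)
    · exact ⟨α, u, hu, fun x hx => ha ((hmem _).mpr ⟨x, hx⟩), h1⟩
    by_cases h2 : Even (β ⬝ᵥ v)
    · exact ⟨β, v, hv, fun x hx => hb.1 ((hmem _).mpr ⟨x, hx⟩), h2⟩
    refine ⟨α - β, u - v, by rw [mulVec_sub, hu, hv, nsmul_sub], fun x hx => hb.2 ?_, ?_⟩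
    · have := (hmem (α - β)).mpr ⟨x, hx⟩
      rw [map_sub, sub_eq_zero] at this
      exact this.symm
    · rw [Int.not_even_iff_odd] at h1 h2
      have h3 : (α - β) ⬝ᵥ (u - v) = (α ⬝ᵥ u + β ⬝ᵥ v) - 2 * (β ⬝ᵥ u) := by
        simp only [sub_dotProduct, dotProduct_sub, hsymm]
        ring
      rw [h3]
      exact (h1.add_odd h2).sub (even_two_mul _)

/-- A form whose discriminant is `± 2 ^ k` with `k ≥ 2` is, on a sublattice and up to the factor
`4`, a form of discriminant `± 2 ^ (k - 2)`. The sublattice is `2 ℤᵐ + ℤ w`; this is the passage to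
the integral overlattice generated by `w / 2`. -/
theorem exists_congr_eq_four_smul {m k : ℕ} {G : Matrix (Fin m) (Fin m) ℤ}
    (hG : G.IsSymm) (hk : 2 ≤ k) (hdet : G.det.natAbs = 2 ^ k) :
    ∃ P H : Matrix (Fin m) (Fin m) ℤ, H.IsSymm ∧ Pᵀ * G * P = 4 • H ∧
      H.det.natAbs = 2 ^ (k - 2) := by
  obtain ⟨φ₀, w₀, hw₀, hφ₀, he₀⟩ := exists_isotropic_mem_discriminant hG hk hdet
  -- reduce `w₀` modulo `2`, so that some coordinate becomes `1`
  set u : Fin m → ℤ := fun i => w₀ i / 2 with hu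
  set w : Fin m → ℤ := w₀ - 2 • u with hw
  set φ : Fin m → ℤ := φ₀ - G *ᵥ u with hφ
  have hGw : G *ᵥ w = 2 • φ := by
    rw [hw, hφ, mulVec_sub, hw₀, mulVec_smul, smul_sub]
  have he : Even (φ ⬝ᵥ w) := by
    have h1 : (G *ᵥ u) ⬝ᵥ w₀ = 2 * (φ₀ ⬝ᵥ u) := by
      rw [dotProduct_comm, dotProduct_mulVec_comm hG, hw₀, dotProduct_smul, dotProduct_comm]
      simp
    have h2 : φ ⬝ᵥ w = φ₀ ⬝ᵥ w₀ + 2 * ((G *ᵥ u) ⬝ᵥ u - 2 * (φ₀ ⬝ᵥ u)) := by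
      simp only [hφ, hw, sub_dotProduct, dotProduct_sub, h1, dotProduct_smul]
      simp only [nsmul_eq_mul]
      push_cast
      ring
    rw [h2]
    exact he₀.add (even_two_mul _)
  have hw01 : ∀ i, w i = 0 ∨ w i = 1 := fun i => by
    have : w i = w₀ i - 2 * (w₀ i / 2) := by simp [hw, hu]
    omega
  obtain ⟨i, hi⟩ : ∃ i, w i = 1 := by
    by_contra h
    push Not at h
    have hw0 : w = 0 := funext fun i => (hw01 i).resolve_right (h i)
    have : φ = 0 := by
      rw [hw0, mulVec_zero] at hGw
      exact (smul_eq_zero.mp hGw.symm).resolve_left (by norm_num)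
    exact hφ₀ u (sub_eq_zero.mp this).symm
  set P : Matrix (Fin m) (Fin m) ℤ := ((2 : ℤ) • (1 : Matrix (Fin m) (Fin m) ℤ)).updateCol i w
    with hP
  have hPdet : P.det = 2 ^ (m - 1) := by
    rw [hP, ← cramer_apply, cramer_eq_adjugate_mulVec, adjugate_smul, adjugate_one,
      smul_mulVec, one_mulVec, Pi.smul_apply, hi]
    simp
  have hPcol : ∀ j, P.col j = if j = i then w else (2 : ℤ) • Pi.single j 1 := fun j => by
    ext l
    by_cases hj : j = i
    · subst hj; simp [hP, col_apply]
    · rw [if_neg hj, col_apply, hP, updateCol_ne hj, Matrix.smul_apply, one_apply]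
      simp [Pi.single_apply]
  have hentry : ∀ j l, (Pᵀ * G * P) j l = P.col j ⬝ᵥ G *ᵥ P.col l := fun j l => by
    have h := dotProduct_congr_mulVec G P (Pi.single j 1) (Pi.single l 1)
    simpa using h
  have hdvd : ∀ j l, (4 : ℤ) ∣ (Pᵀ * G * P) j l := fun j l => by
    rw [hentry, hPcol, hPcol]
    by_cases hj : j = i <;> by_cases hl : l = i
    · rw [if_pos hj, if_pos hl, hGw, dotProduct_smul, dotProduct_comm]
      obtain ⟨r, hr⟩ := he
      exact ⟨r, by rw [hr]; simp; ring⟩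
    · rw [if_pos hj, if_neg hl, dotProduct_mulVec_comm hG, hGw, dotProduct_smul, smul_dotProduct]
      exact ⟨_, by simp; ring_nf⟩
    · rw [if_neg hj, if_pos hl, hGw, dotProduct_smul, smul_dotProduct]
      exact ⟨_, by simp; ring_nf⟩
    · rw [if_neg hj, if_neg hl, mulVec_smul, dotProduct_smul, smul_dotProduct]
      exact ⟨_, by simp; ring_nf⟩
  choose H hH using hdvd
  have hPH : Pᵀ * G * P = 4 • (Matrix.of H) := by
    ext j l
    simp [hH]
  refine ⟨P, Matrix.of H, ?_, hPH, ?_⟩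
  · ext j l
    have h1 : (Pᵀ * G * P)ᵀ = Pᵀ * G * P := by
      rw [transpose_mul, transpose_mul, transpose_transpose, hG.eq, Matrix.mul_assoc]
    have h2 := congrFun (congrFun h1 j) l
    rw [hPH] at h2
    simpa using h2
  · have h1 := congrArg (fun A => (det A).natAbs) hPH
    simp only [det_mul, det_transpose, hPdet, Int.natAbs_mul, hdet] at h1
    rw [← natCast_zsmul, det_smul, Fintype.card_fin, Int.natAbs_mul, Int.natAbs_pow,
      Int.natAbs_pow] at h1
    have hm : 1 ≤ m := by have := i.2; omega
    obtain ⟨n, rfl⟩ := Nat.exists_eq_add_of_le' hm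
    obtain ⟨k, rfl⟩ := Nat.exists_eq_add_of_le' hk
    norm_num at h1 ⊢
    have h4 : (4 : ℕ) ^ (n + 1) = 2 ^ n * 2 ^ n * 4 := by
      rw [pow_succ, show 4 = 2 * 2 by norm_num, mul_pow]
    rw [h4] at h1
    have h5 : (2 ^ n * 2 ^ n * 4) * 2 ^ k = (2 ^ n * 2 ^ n * 4) * (of H).det.natAbs := by
      rw [← h1]; ring
    exact (Nat.eq_of_mul_eq_mul_left (by positivity) h5).symm

/-- Modulo `2`, the quadratic form `x ↦ xᵀ G x` is additive. -/
theorem even_value_sub_sum_diag {m : ℕ} {G : Matrix (Fin m) (Fin m) ℤ} (hG : G.IsSymm)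
    (x : Fin m → ℤ) : Even (x ⬝ᵥ G *ᵥ x - ∑ i, x i * G i i) := by
  let q : (Fin m → ℤ) →+ ZMod 2 :=
    { toFun := fun x => ((x ⬝ᵥ G *ᵥ x : ℤ) : ZMod 2)
      map_zero' := by simp
      map_add' := fun x y => by
        have : (x + y) ⬝ᵥ G *ᵥ (x + y) = x ⬝ᵥ G *ᵥ x + y ⬝ᵥ G *ᵥ y + 2 * (y ⬝ᵥ G *ᵥ x) := by
          simp only [add_dotProduct, mulVec_add, dotProduct_add, dotProduct_mulVec_comm hG x y]
          ring
        rw [this]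
        push_cast
        rw [show (2 : ZMod 2) = 0 from rfl]
        ring }
  have hq : q x = ((∑ i, x i * G i i : ℤ) : ZMod 2) := by
    conv_lhs => rw [pi_eq_sum_univ' x]
    rw [map_sum]
    push_cast
    refine Finset.sum_congr rfl fun i _ => ?_
    rw [map_zsmul, zsmul_eq_mul]
    congr 1
    change ((_ : ℤ) : ZMod 2) = _
    congr 1
    simp
  rw [even_iff_two_dvd]
  apply (ZMod.intCast_zmod_eq_zero_iff_dvd _ 2).mp
  rw [Int.cast_sub, ← hq]
  exact sub_self _

/-- Every symmetric integral form is even on a sublattice of index `1` or `2`. -/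
theorem exists_even_congr {m : ℕ} {G : Matrix (Fin m) (Fin m) ℤ} (hG : G.IsSymm) :
    ∃ P : Matrix (Fin m) (Fin m) ℤ, (P.det = 1 ∨ P.det = 2) ∧
      ∀ x, Even (x ⬝ᵥ (Pᵀ * G * P) *ᵥ x) := by
  by_cases h : ∀ i, Even (G i i)
  · refine ⟨1, Or.inl det_one, fun x => ?_⟩
    have h1 := even_value_sub_sum_diag hG x
    have h2 : Even (∑ i, x i * G i i) := Finset.even_sum _ fun i _ => (h i).mul_left _
    simpa using h1.add h2
  · push Not at h
    obtain ⟨i, hi⟩ := h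
    rw [Int.not_even_iff_odd] at hi
    set c : Fin m → ℤ := fun j => if j = i then 2 else G j j with hc
    set P : Matrix (Fin m) (Fin m) ℤ := (1 : Matrix (Fin m) (Fin m) ℤ).updateRow i c with hP
    refine ⟨P, Or.inr ?_, fun x => ?_⟩
    · rw [hP, ← det_transpose, ← updateCol_transpose, ← cramer_apply, transpose_one, cramer_one]
      simp [hc]
    · rw [dotProduct_congr_mulVec]
      have h1 := even_value_sub_sum_diag hG (P *ᵥ x)
      have h2 : ∀ j, j ≠ i → (P *ᵥ x) j = x j := fun j hj => by
        simp [mulVec, hP, updateRow_ne hj, one_apply, dotProduct]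
      have h3 : (P *ᵥ x) i = 2 * x i + ∑ j ∈ Finset.univ.erase i, G j j * x j := by
        simp only [mulVec, hP, updateRow_self, dotProduct]
        rw [← Finset.add_sum_erase _ _ (Finset.mem_univ i)]
        congr 1
        · simp [hc]
        · refine Finset.sum_congr rfl fun j hj => ?_
          simp [hc, Finset.ne_of_mem_erase hj]
      have h4 : Even (∑ j, (P *ᵥ x) j * G j j) := by
        rw [← Finset.add_sum_erase _ _ (Finset.mem_univ i), h3,
          Finset.sum_congr rfl (fun j hj => by rw [h2 j (Finset.ne_of_mem_erase hj), mul_comm] :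
            ∀ j ∈ Finset.univ.erase i, (P *ᵥ x) j * G j j = G j j * x j)]
        obtain ⟨r, hr⟩ := hi
        rw [hr]
        exact ⟨x i * (2 * r + 1) + (r + 1) * ∑ j ∈ Finset.univ.erase i, G j j * x j, by ring⟩
      simpa using h1.add h4

/-- If a form of discriminant `± 2 ^ k` is isotropic, it represents a power of `4`. -/
theorem exists_value_eq_of_isotropic {m k : ℕ} {G : Matrix (Fin m) (Fin m) ℤ} (hG : G.IsSymm)
    (hdet : G.det.natAbs = 2 ^ k) {x : Fin m → ℤ} (hx : x ≠ 0) (hx0 : x ⬝ᵥ G *ᵥ x = 0) :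
    ∃ z : Fin m → ℤ, z ⬝ᵥ G *ᵥ z = 4 ^ (k + 1) := by
  obtain ⟨g, hg⟩ := IsPrincipalIdealRing.principal (Ideal.span (Set.range x))
  have hgx : ∀ i, ∃ c, x i = g * c := fun i => by
    have : x i ∈ Ideal.span {g} := by
      rw [show Ideal.span {g} = Ideal.span (Set.range x) from hg.symm]
      exact Ideal.subset_span ⟨i, rfl⟩
    exact Ideal.mem_span_singleton.mp this
  choose x' hx' using hgx
  have hxx : x = g • x' := funext fun i => by simp [hx']
  have hg0 : g ≠ 0 := by
    rintro rfl
    exact hx (by simp [hxx])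
  obtain ⟨φ, hφ⟩ : ∃ φ : Fin m → ℤ, φ ⬝ᵥ x' = 1 := by
    have : g ∈ Ideal.span (Set.range x) := by
      rw [hg]
      exact Ideal.mem_span_singleton_self g
    obtain ⟨φ, hφ⟩ := Ideal.mem_span_range_iff_exists_fun.mp this
    refine ⟨φ, mul_left_cancel₀ hg0 ?_⟩
    change φ ⬝ᵥ x = g at hφ
    rw [hxx, dotProduct_smul, smul_eq_mul] at hφ
    rw [hφ, mul_one]
  have hx0' : x' ⬝ᵥ G *ᵥ x' = 0 := by
    rw [hxx, mulVec_smul, dotProduct_smul, smul_dotProduct, smul_eq_mul, smul_eq_mul] at hx0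
    simpa [hg0] using hx0
  set y := G.adjugate *ᵥ φ with hy
  have hxy : x' ⬝ᵥ G *ᵥ y = G.det := by
    rw [hy, mulVec_mulVec, mul_adjugate, smul_mulVec, one_mulVec, dotProduct_smul,
      dotProduct_comm, hφ, smul_eq_mul, mul_one]
  have hd2 : G.det ^ 2 = 4 ^ k := by
    rw [← Int.natAbs_sq, hdet]
    push_cast
    rw [← pow_mul, mul_comm, pow_mul]
    norm_num
  refine ⟨(1 - y ⬝ᵥ G *ᵥ y) • x' + (2 * G.det) • y, ?_⟩
  simp only [mulVec_add, mulVec_smul, add_dotProduct, dotProduct_add, smul_dotProduct,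
    dotProduct_smul, smul_eq_mul, hx0', hxy, dotProduct_mulVec_comm hG y x']
  rw [pow_succ, ← hd2]
  ring

/-- A form of rank between `1` and `18` whose discriminant is a power of `2` up to sign represents
a power of `2` up to sign. -/
theorem exists_value_natAbs_eq_two_pow {m : ℕ} (h1 : 1 ≤ m) (h18 : m ≤ 18) (k : ℕ) :
    ∀ {G : Matrix (Fin m) (Fin m) ℤ}, G.IsSymm → G.det.natAbs = 2 ^ k →
      ∃ (x : Fin m → ℤ) (j : ℕ), (x ⬝ᵥ G *ᵥ x).natAbs = 2 ^ j := by
  induction k using Nat.strong_induction_on with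
  | _ k ih =>
  intro G hG hdet
  obtain hk | hk := le_or_gt 2 k
  · obtain ⟨P, H, hH, hPH, hHdet⟩ := exists_congr_eq_four_smul hG hk hdet
    obtain ⟨x, j, hx⟩ := ih (k - 2) (by omega) hH hHdet
    refine ⟨P *ᵥ x, j + 2, ?_⟩
    rw [← dotProduct_congr_mulVec, hPH, smul_mulVec, dotProduct_smul, nsmul_eq_mul,
      Int.natAbs_mul, hx, pow_add, mul_comm]
    rfl
  obtain rfl | h2 : m = 1 ∨ 2 ≤ m := by omega
  · refine ⟨fun _ => 1, k, ?_⟩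
    rw [← hdet]
    simp [dotProduct, mulVec]
  obtain ⟨P, hP, heven⟩ := exists_even_congr hG
  set H := Pᵀ * G * P with hH
  have hHsymm : H.IsSymm := by
    rw [IsSymm, hH, transpose_mul, transpose_mul, transpose_transpose, hG.eq, Matrix.mul_assoc]
  obtain ⟨l, hl, hHdet⟩ : ∃ l ≤ 3, H.det.natAbs = 2 ^ l := by
    have : H.det.natAbs = P.det.natAbs ^ 2 * 2 ^ k := by
      rw [hH, det_mul, det_mul, det_transpose, Int.natAbs_mul, Int.natAbs_mul, hdet]
      ring
    obtain hP | hP := hP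
    · exact ⟨k, by omega, by rw [this, hP]; simp⟩
    · exact ⟨k + 2, by omega, by rw [this, hP, pow_add]; simp [mul_comm]⟩
  have h8 : |H.det| ≤ 8 := by
    rw [Int.abs_eq_natAbs, hHdet]
    exact_mod_cast Nat.pow_le_pow_right (show 0 < 2 by norm_num) hl
  have h0 : H.det ≠ 0 := by
    intro h
    rw [h] at hHdet
    exact absurd hHdet.symm (by simp)
  obtain ⟨x, hx, hx6⟩ := exists_abs_value_lt_six h2 h18 H hHsymm h0 h8
  by_cases hx0 : x ⬝ᵥ H *ᵥ x = 0
  · obtain ⟨z, hz⟩ := exists_value_eq_of_isotropic hHsymm hHdet hx hx0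
    refine ⟨P *ᵥ z, 2 * (l + 1), ?_⟩
    rw [← dotProduct_congr_mulVec, ← hH, hz, pow_mul]
    norm_num [Int.natAbs_pow]
  · obtain ⟨r, hr⟩ := heven x
    refine ⟨P *ᵥ x, (x ⬝ᵥ H *ᵥ x).natAbs / 2, ?_⟩
    rw [← dotProduct_congr_mulVec, ← hH]
    rw [abs_lt] at hx6
    have : (x ⬝ᵥ H *ᵥ x).natAbs = 2 ∨ (x ⬝ᵥ H *ᵥ x).natAbs = 4 := by omega
    obtain h | h := this <;> rw [h] <;> norm_num

/-! ### Rational diagonalization -/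

section
variable {L : Type*} [AddCommGroup L]

/-- `c L* ⊆ L`: every functional on `L` becomes, after multiplication by `c`, the pairing with a
vector of `L`. For `c = 1` and a nondegenerate form this is unimodularity. -/
def ScalesDual (B : LinearMap.BilinForm ℤ L) (c : ℤ) : Prop :=
  ∀ φ : L →ₗ[ℤ] ℤ, ∃ x, ∀ y, B x y = c * φ y

theorem isSymm_toMatrix {ι : Type*} [Fintype ι] [DecidableEq ι] {B : LinearMap.BilinForm ℤ L}
    (hB : B.IsSymm) (b : Module.Basis ι ℤ L) : (LinearMap.BilinForm.toMatrix b B).IsSymm := by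
  ext i j
  simp [LinearMap.BilinForm.toMatrix_apply, hB.eq (b j)]

theorem toMatrix_mulVec_repr {n : ℕ} {B : LinearMap.BilinForm ℤ L} (hB : B.IsSymm)
    (b : Module.Basis (Fin n) ℤ L) (x : L) :
    LinearMap.BilinForm.toMatrix b B *ᵥ ⇑(b.repr x) = fun i => B x (b i) := by
  ext i
  rw [hB.eq, B.apply_eq_dotProduct_toMatrix_mulVec b (b i) x]
  simp [Finsupp.single_eq_pi_single]

/-- Cramer's rule: the discriminant kills the discriminant group. -/
theorem scalesDual_det {n : ℕ} {B : LinearMap.BilinForm ℤ L} (hB : B.IsSymm)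
    (b : Module.Basis (Fin n) ℤ L) :
    ScalesDual B (LinearMap.BilinForm.toMatrix b B).det := fun φ => by
  set G := LinearMap.BilinForm.toMatrix b B with hG
  refine ⟨b.equivFun.symm (G.adjugate *ᵥ fun i => φ (b i)), fun y => ?_⟩
  set x := b.equivFun.symm (G.adjugate *ᵥ fun i => φ (b i)) with hx
  have h1 : ∀ i, B x (b i) = G.det * φ (b i) := fun i => by
    have h2 := congrFun (toMatrix_mulVec_repr hB b x) i
    rw [← h2, ← hG, show ⇑(b.repr x) = G.adjugate *ᵥ fun i => φ (b i) from
      b.equivFun.apply_symm_apply _, mulVec_mulVec, mul_adjugate, smul_mulVec, one_mulVec]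
    rfl
  have h3 : B x = G.det • φ := b.ext fun i => by simpa using h1 i
  rw [h3]
  simp

/-- If `c` times the dual lattice lies in `L`, then the Gram matrix divides `c • 1`, so its
determinant divides a power of `c`. -/
theorem exists_det_mul_eq_pow {n : ℕ} {B : LinearMap.BilinForm ℤ L} (hB : B.IsSymm)
    (b : Module.Basis (Fin n) ℤ L) {c : ℤ} (hc : ScalesDual B c) :
    ∃ d, (LinearMap.BilinForm.toMatrix b B).det * d = c ^ n := by
  choose x hx using fun i => hc (b.coord i)
  set H : Matrix (Fin n) (Fin n) ℤ := Matrix.of fun i j => b.repr (x j) i with hH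
  have h : LinearMap.BilinForm.toMatrix b B * H = c • 1 := by
    ext i j
    have h1 := congrFun (toMatrix_mulVec_repr hB b (x j)) i
    have h2 : (LinearMap.BilinForm.toMatrix b B * H) i j =
        (LinearMap.BilinForm.toMatrix b B *ᵥ ⇑(b.repr (x j))) i := rfl
    rw [h2, h1, hx, Matrix.smul_apply, one_apply]
    simp [Finsupp.single_apply]
  refine ⟨H.det, ?_⟩
  rw [← det_mul, h, det_smul]
  simp

theorem restrict_apply' (B : LinearMap.BilinForm ℤ L) (W : Submodule ℤ L) (x y : W) :
    B.restrict W x y = B x y := rfl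

theorem isSymm_restrict {B : LinearMap.BilinForm ℤ L} (hB : B.IsSymm) (W : Submodule ℤ L) :
    (B.restrict W).IsSymm := ⟨fun x y => hB.eq x y⟩

/-- The dual of `z⊥` is controlled by the dual of `L`: a functional on `z⊥` is extended to `L` by
composition with the projection `y ↦ (z, z) y - (y, z) z`. -/
theorem ScalesDual.restrict_ker {B : LinearMap.BilinForm ℤ L} {c : ℤ}
    (hc : ScalesDual B c) (z : L) :
    ScalesDual (B.restrict (LinearMap.ker (B z))) (B z z ^ 2 * c) := fun φ => by
  have hp : ∀ y, B z z • y - B z y • z ∈ LinearMap.ker (B z) := fun y => by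
    simp [mul_comm]
  let p : L →ₗ[ℤ] LinearMap.ker (B z) :=
    LinearMap.codRestrict _ (B z z • LinearMap.id - (B z).smulRight z) hp
  obtain ⟨x, hx⟩ := hc (φ ∘ₗ p)
  refine ⟨p x, fun y => ?_⟩
  have hy : B z y = 0 := y.2
  have h1 : p y = B z z • y := Subtype.ext (by simp [p, hy])
  have h2 : ((p x : LinearMap.ker (B z)) : L) = B z z • x - B z x • z := rfl
  rw [restrict_apply', h2]
  have h3 := hx y
  simp only [LinearMap.comp_apply, h1, map_smul, smul_eq_mul] at h3
  simp only [map_sub, map_smul, LinearMap.sub_apply, LinearMap.smul_apply, smul_eq_mul, hy, h3]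
  ring

theorem finrank_ker_add_one [Module.Finite ℤ L] {φ : L →ₗ[ℤ] ℤ} (hφ : φ ≠ 0) :
    Module.finrank ℤ (LinearMap.ker φ) + 1 = Module.finrank ℤ L := by
  have h1 := Submodule.finrank_quotient_add_finrank (LinearMap.ker φ)
  rw [φ.quotKerEquivRange.finrank_eq] at h1
  have h2 : Module.finrank ℤ (LinearMap.range φ) ≤ 1 := by
    simpa using Submodule.finrank_le (LinearMap.range φ)
  have h3 : 0 < Module.finrank ℤ (LinearMap.range φ) := by
    have : Nontrivial (LinearMap.range φ) :=
      Submodule.nontrivial_iff_ne_bot.mpr (fun h => hφ (LinearMap.range_eq_bot.mp h))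
    exact Module.finrank_pos
  omega

end

/-- The rational forms `⟨±2⟩ ⊕ ⟨±2⟩` and `⟨±1⟩ ⊕ ⟨±1⟩` are isometric, whence an orthogonal pair
whose norms are powers of `2` up to sign can be replaced with one where the second norm is a power
of `4` up to sign. -/
theorem exists_orthogonal_pair {L : Type*} [AddCommGroup L] {B : LinearMap.BilinForm ℤ L}
    (hB : B.IsSymm) {p q : L} (hpq : B p q = 0) {a b : ℕ} (hp : (B p p).natAbs = 2 ^ a)
    (hq : (B q q).natAbs = 2 ^ b) :
    ∃ α β γ δ : ℤ, B (α • p + β • q) (γ • p + δ • q) = 0 ∧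
      (∃ j : ℕ, (B (α • p + β • q) (α • p + β • q)).natAbs = 2 ^ j) ∧
      ∃ j : ℕ, (B (γ • p + δ • q) (γ • p + δ • q)).natAbs = 4 ^ j := by
  have hqp : B q p = 0 := by rw [hB.eq, hpq]
  have key : ∀ α β γ δ : ℤ, B (α • p + β • q) (γ • p + δ • q) =
      α * γ * B p p + β * δ * B q q := fun α β γ δ => by
    simp only [map_add, map_smul, LinearMap.add_apply, LinearMap.smul_apply, smul_eq_mul, hpq, hqp]
    ring
  simp only [key]
  have h4 : ∀ n : ℕ, (2 : ℕ) ^ (n + n) = 4 ^ n := fun n => by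
    rw [← two_mul, pow_mul]; norm_num
  obtain ⟨b', rfl⟩ | hbo := Nat.even_or_odd b
  · exact ⟨1, 0, 0, 1, by simp, ⟨a, by simpa using hp⟩, b', by simpa [h4] using hq⟩
  obtain ⟨a', rfl⟩ | hao := Nat.even_or_odd a
  · exact ⟨0, 1, 1, 0, by simp, ⟨b, by simpa using hq⟩, a', by simpa [h4] using hp⟩
  obtain ⟨a', rfl⟩ := hao
  obtain ⟨b', rfl⟩ := hbo
  have hpp : B p p = 2 * 4 ^ a' ∨ B p p = -(2 * 4 ^ a') := by
    have : (2 : ℤ) * 4 ^ a' = ((2 ^ (2 * a' + 1) : ℕ) : ℤ) := by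
      push_cast; rw [pow_succ, pow_mul]; norm_num [mul_comm]
    rw [this, ← hp]
    exact Int.natAbs_eq _
  have hqq : B q q = 2 * 4 ^ b' ∨ B q q = -(2 * 4 ^ b') := by
    have : (2 : ℤ) * 4 ^ b' = ((2 ^ (2 * b' + 1) : ℕ) : ℤ) := by
      push_cast; rw [pow_succ, pow_mul]; norm_num [mul_comm]
    rw [this, ← hq]
    exact Int.natAbs_eq _
  have ha4 : (4 : ℤ) ^ a' = 2 ^ a' * 2 ^ a' := by rw [← mul_pow]; norm_num
  have hb4 : (4 : ℤ) ^ b' = 2 ^ b' * 2 ^ b' := by rw [← mul_pow]; norm_num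
  have fin : ∀ (v : ℤ) (j : ℕ), (v = 4 ^ j ∨ v = -4 ^ j) → v.natAbs = 4 ^ j := by
    rintro v j (rfl | rfl) <;> simp [Int.natAbs_pow]
  have h24 : ∀ (v : ℤ) (j : ℕ), (v = 4 ^ j ∨ v = -4 ^ j) → v.natAbs = 2 ^ (j + j) :=
    fun v j h => by rw [h4, fin v j h]
  -- after scaling by `2 ^ b'` and `2 ^ a'` both norms are `± 2 * 4 ^ (a' + b')`
  obtain hpp | hpp := hpp <;> obtain hqq | hqq := hqq <;> rw [hpp, hqq, ha4, hb4]
  · refine ⟨2 ^ b', 2 ^ a', 2 ^ b', -2 ^ a', by ring, ⟨_, h24 _ (a' + b' + 1) ?_⟩,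
      _, fin _ (a' + b' + 1) ?_⟩ <;> left <;> rw [pow_succ, pow_add, ha4, hb4] <;> ring
  · refine ⟨3 * 2 ^ b', 2 ^ a', 2 ^ b', 3 * 2 ^ a', by ring, ⟨_, h24 _ (a' + b' + 2) ?_⟩,
      _, fin _ (a' + b' + 2) ?_⟩
    · left; rw [pow_add, pow_add, ha4, hb4]; ring
    · right; rw [pow_add, pow_add, ha4, hb4]; ring
  · refine ⟨3 * 2 ^ b', 2 ^ a', 2 ^ b', 3 * 2 ^ a', by ring, ⟨_, h24 _ (a' + b' + 2) ?_⟩,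
      _, fin _ (a' + b' + 2) ?_⟩
    · right; rw [pow_add, pow_add, ha4, hb4]; ring
    · left; rw [pow_add, pow_add, ha4, hb4]; ring
  · refine ⟨2 ^ b', 2 ^ a', 2 ^ b', -2 ^ a', by ring, ⟨_, h24 _ (a' + b' + 1) ?_⟩,
      _, fin _ (a' + b' + 1) ?_⟩ <;> right <;> rw [pow_succ, pow_add, ha4, hb4] <;> ring

theorem exists_natAbs_self_eq_two_pow {L : Type*} [AddCommGroup L] [Module.Free ℤ L]
    [Module.Finite ℤ L] {B : LinearMap.BilinForm ℤ L} (hB : B.IsSymm) {N : ℕ}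
    (hN : ScalesDual B (2 ^ N)) (h1 : 1 ≤ Module.finrank ℤ L) (h18 : Module.finrank ℤ L ≤ 18) :
    ∃ (z : L) (j : ℕ), (B z z).natAbs = 2 ^ j := by
  let b := Module.finBasis ℤ L
  obtain ⟨d, hd⟩ := exists_det_mul_eq_pow hB b hN
  have h2 : (LinearMap.BilinForm.toMatrix b B).det.natAbs ∣ 2 ^ (N * Module.finrank ℤ L) := by
    refine ⟨d.natAbs, ?_⟩
    rw [← Int.natAbs_mul, hd, ← pow_mul, Int.natAbs_pow]
    rfl
  obtain ⟨k, -, hk⟩ := (Nat.dvd_prime_pow Nat.prime_two).mp h2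
  obtain ⟨x, j, hx⟩ := exists_value_natAbs_eq_two_pow h1 h18 k (isSymm_toMatrix hB b) hk
  refine ⟨b.equivFun.symm x, j, ?_⟩
  rw [B.apply_eq_dotProduct_toMatrix_mulVec b, ← hx]
  have : ⇑(b.repr (b.equivFun.symm x)) = x := b.equivFun.apply_symm_apply x
  rw [this]

/-- A lattice of rank at most `18` whose discriminant group is a `2`-group has, over `ℚ`, an
orthogonal basis with norms `± 1` and `± 2`, where `± 2` occurs at most once. -/
theorem exists_orthogonal_family (n : ℕ) (h18 : n + 1 ≤ 18) :
    ∀ {L : Type u} [AddCommGroup L] [Module.Free ℤ L] [Module.Finite ℤ L]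
      {B : LinearMap.BilinForm ℤ L} {N : ℕ}, B.IsSymm → ScalesDual B (2 ^ N) →
      Module.finrank ℤ L = n + 1 →
      ∃ b : Fin (n + 1) → L, (∀ i j, i ≠ j → B (b i) (b j) = 0) ∧
        (∃ j : ℕ, (B (b 0) (b 0)).natAbs = 2 ^ j) ∧
        ∀ i : Fin n, ∃ j : ℕ, (B (b i.succ) (b i.succ)).natAbs = 4 ^ j := by
  induction n with
  | zero =>
    intro L _ _ _ B N hB hN hL
    obtain ⟨z, j, hz⟩ := exists_natAbs_self_eq_two_pow hB hN (by omega) (by omega)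
    exact ⟨fun _ => z, fun i j h => absurd (Fin.ext (by omega)) h, ⟨j, hz⟩, fun i => i.elim0⟩
  | succ n ih =>
    intro L _ _ _ B N hB hN hL
    obtain ⟨z, j, hz⟩ := exists_natAbs_self_eq_two_pow hB hN (by omega) (by omega)
    have hz0 : B z ≠ 0 := by
      intro h
      rw [h] at hz
      exact absurd hz.symm (by simp)
    have hN' : ScalesDual (B.restrict (LinearMap.ker (B z))) (2 ^ (2 * j + N)) := by
      have := hN.restrict_ker z
      rwa [← Int.natAbs_sq, hz, show (((2 ^ j : ℕ) : ℤ)) ^ 2 * 2 ^ N = 2 ^ (2 * j + N) by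
        push_cast; ring] at this
    obtain ⟨b, hb, ⟨l, hl⟩, hb4⟩ := ih (by omega) (isSymm_restrict hB _) hN'
      (by have := finrank_ker_add_one hz0; omega)
    have hbz : ∀ i, B z (b i) = 0 := fun i => (b i).2
    have hzb : ∀ i, B (b i) z = 0 := fun i => by rw [hB.eq, hbz]
    have hb' : ∀ i j, i ≠ j → B (b i) (b j) = 0 := hb
    obtain ⟨α, β, γ, δ, h1, h2, h3⟩ := exists_orthogonal_pair hB (hbz 0) hz hl
    set p := α • z + β • (b 0 : L) with hp
    set q := γ • z + δ • (b 0 : L) with hq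
    have hpb : ∀ i : Fin n, B p (b i.succ) = 0 := fun i => by
      simp [hp, hbz, hb' 0 i.succ (Fin.succ_ne_zero i).symm]
    have hqb : ∀ i : Fin n, B q (b i.succ) = 0 := fun i => by
      simp [hq, hbz, hb' 0 i.succ (Fin.succ_ne_zero i).symm]
    refine ⟨Fin.cons p (Fin.cons q fun i => (b i.succ : L)), ?_, h2, ?_⟩
    · intro i j hij
      induction i using Fin.cases with
      | zero =>
        induction j using Fin.cases with
        | zero => exact absurd rfl hij
        | succ j =>
          induction j using Fin.cases with
          | zero => exact h1
          | succ j => exact hpb j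
      | succ i =>
        induction i using Fin.cases with
        | zero =>
          induction j using Fin.cases with
          | zero => exact (hB.eq _ _).trans h1
          | succ j =>
            induction j using Fin.cases with
            | zero => exact absurd rfl hij
            | succ j => exact hqb j
        | succ i =>
          induction j using Fin.cases with
          | zero => exact (hB.eq _ _).trans (hpb i)
          | succ j =>
            induction j using Fin.cases with
            | zero => exact (hB.eq _ _).trans (hqb i)
            | succ j =>
              exact hb' _ _ fun h => hij (by rw [h])
    · intro i
      induction i using Fin.cases with
      | zero => exact h3
      | succ i => exact hb4 i

/-- The determinant of the Gram matrix of an orthogonal family is the discriminant times a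
square. -/
theorem exists_prod_eq_det_mul_sq {L : Type*} [AddCommGroup L] {n : ℕ}
    (B : LinearMap.BilinForm ℤ L) (b : Module.Basis (Fin n) ℤ L) {h : Fin n → L}
    (hh : ∀ i j, i ≠ j → B (h i) (h j) = 0) :
    ∃ d, ∏ i, B (h i) (h i) = (LinearMap.BilinForm.toMatrix b B).det * d ^ 2 := by
  set P : Matrix (Fin n) (Fin n) ℤ := b.toMatrix h with hP
  set G := LinearMap.BilinForm.toMatrix b B with hG
  have h1 : Pᵀ * G * P = diagonal fun i => B (h i) (h i) := by
    ext i j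
    have h2 := dotProduct_congr_mulVec G P (Pi.single i 1) (Pi.single j 1)
    have h3 : ∀ i, P.col i = ⇑(b.repr (h i)) := fun i => rfl
    have h4 : (Pᵀ * G * P) i j = B (h i) (h j) := by
      rw [B.apply_eq_dotProduct_toMatrix_mulVec b, ← h3, ← h3]
      simpa using h2
    rw [h4]
    by_cases hij : i = j
    · subst hij; simp
    · rw [diagonal_apply_ne _ hij, hh i j hij]
  refine ⟨P.det, ?_⟩
  rw [← det_diagonal, ← h1, det_mul, det_mul, det_transpose]
  ring

theorem even_of_two_pow_mul_sq_eq_sq {j x y : ℕ} (hx : x ≠ 0) (h : 2 ^ j * x ^ 2 = y ^ 2) :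
    Even j := by
  have hy : y ≠ 0 := by
    rintro rfl
    simp [hx] at h
  have h1 := congrArg (fun n => n.factorization 2) h
  simp only [Nat.factorization_mul (pow_ne_zero j two_ne_zero) (pow_ne_zero 2 hx),
    Nat.factorization_pow, Finsupp.add_apply, Finsupp.smul_apply, smul_eq_mul,
    Nat.prime_two.factorization_self, mul_one] at h1
  rw [Nat.even_iff]
  omega

/-- A lattice of rank at most `18` and discriminant `± 4 ^ k` is rationally a sum of forms `⟨1⟩`
and `⟨-1⟩`. -/
theorem exists_orthogonal_frame {n : ℕ} (h18 : n + 1 ≤ 18) {L : Type u} [AddCommGroup L]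
    {B : LinearMap.BilinForm ℤ L} (hB : B.IsSymm) (e : Module.Basis (Fin (n + 1)) ℤ L) {k : ℕ}
    (hdet : (LinearMap.BilinForm.toMatrix e B).det.natAbs = 4 ^ k) :
    ∃ (K : ℕ) (h : Fin (n + 1) → L) (ε : Fin (n + 1) → ℤ), (∀ i, ε i = 1 ∨ ε i = -1) ∧
      ∀ i j, B (h i) (h j) = if i = j then ε i * 4 ^ K else 0 := by
  have : Module.Free ℤ L := Module.Free.of_basis e
  have : Module.Finite ℤ L := Module.Finite.of_basis e
  have hrank : Module.finrank ℤ L = n + 1 := by simpa using Module.finrank_eq_card_basis e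
  have hN : ScalesDual B (2 ^ (2 * k)) := fun φ => by
    obtain ⟨x, hx⟩ := scalesDual_det hB e φ
    have h4 : (2 : ℤ) ^ (2 * k) = ((4 ^ k : ℕ) : ℤ) := by
      push_cast; rw [pow_mul]; norm_num
    rw [h4, ← hdet]
    obtain h | h := Int.natAbs_eq (LinearMap.BilinForm.toMatrix e B).det
    · exact ⟨x, fun y => by rw [hx, ← h]⟩
    · refine ⟨-x, fun y => ?_⟩
      rw [map_neg, LinearMap.neg_apply, hx]
      conv_lhs => rw [h]
      ring
  obtain ⟨b, hb, ⟨l, hl⟩, hb4⟩ := exists_orthogonal_family n h18 hB hN hrank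
  choose s hs using hb4
  obtain ⟨d, hd⟩ := exists_prod_eq_det_mul_sq B e hb
  have heven : Even l := by
    have h1 := congrArg Int.natAbs hd
    rw [Fin.prod_univ_succ, Int.natAbs_mul, hl, Int.natAbs_mul, hdet, Int.natAbs_pow] at h1
    rw [← Int.natAbsHom_apply, map_prod] at h1
    simp only [Int.natAbsHom_apply, hs] at h1
    refine even_of_two_pow_mul_sq_eq_sq (j := l) (x := ∏ i, 2 ^ s i) (y := 2 ^ k * d.natAbs) ?_ ?_
    · exact Finset.prod_ne_zero_iff.mpr fun i _ => by positivity
    · rw [← Finset.prod_pow, mul_pow, ← pow_mul, mul_comm k, pow_mul]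
      simp only [← pow_mul, mul_comm _ 2]
      simp only [pow_mul]
      exact h1
  obtain ⟨l', rfl⟩ := heven
  have hall : ∀ i, ∃ t : ℕ, (B (b i) (b i)).natAbs = 4 ^ t := fun i => by
    induction i using Fin.cases with
    | zero => exact ⟨l', by rw [hl, ← two_mul, pow_mul]; norm_num⟩
    | succ i => exact ⟨s i, hs i⟩
  choose t ht using hall
  have hle : ∀ i, t i ≤ ∑ i, t i := fun i =>
    Finset.single_le_sum (f := t) (fun _ _ => Nat.zero_le _) (Finset.mem_univ i)
  refine ⟨∑ i, t i, fun i => (2 : ℤ) ^ (∑ i, t i - t i) • b i, fun i => (B (b i) (b i)).sign,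
    fun i => ?_, fun i j => ?_⟩
  · have h0 : B (b i) (b i) ≠ 0 := by
      intro h
      have := ht i
      rw [h] at this
      exact absurd this.symm (by simp)
    obtain h | h := lt_or_gt_of_ne h0
    · exact Or.inr (Int.sign_eq_neg_one_of_neg h)
    · exact Or.inl (Int.sign_eq_one_of_pos h)
  · by_cases hij : i = j
    · subst hij
      simp only [if_true, map_smul, LinearMap.smul_apply, smul_eq_mul]
      conv_lhs => rw [← Int.sign_mul_natAbs (B (b i) (b i)), ht]
      have h1 : (4 : ℤ) ^ (∑ i, t i) = 4 ^ (∑ i, t i - t i) * 4 ^ t i := by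
        rw [← pow_add, Nat.sub_add_cancel (hle i)]
      have h2 : (4 : ℤ) ^ (∑ i, t i - t i) = 2 ^ (∑ i, t i - t i) * 2 ^ (∑ i, t i - t i) := by
        rw [← mul_pow]; norm_num
      rw [h1, h2]
      push_cast
      ring
    · simp [hij, hb i j hij]

/-! ### Even unimodular overlattices -/

section
variable {L : Type*} [AddCommGroup L]

theorem linearIndependent_of_orthogonal {n : ℕ} {B : LinearMap.BilinForm ℤ L} {h : Fin n → L}
    (hh : ∀ i j, i ≠ j → B (h i) (h j) = 0) (h0 : ∀ i, B (h i) (h i) ≠ 0) :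
    LinearIndependent ℤ h := by
  rw [Fintype.linearIndependent_iff]
  intro c hc j
  have h1 := congrArg (fun y => B y (h j)) hc
  simp only [map_sum, LinearMap.sum_apply, map_smul, LinearMap.smul_apply, smul_eq_mul, map_zero,
    LinearMap.zero_apply] at h1
  rw [Finset.sum_eq_single j (fun i _ hij => by rw [hh i j hij, mul_zero]) (by simp)] at h1
  exact (mul_eq_zero.mp h1).resolve_right (h0 j)

/-- An orthogonal family of maximal length with nonzero norms has no vector orthogonal to it. -/
theorem apply_eq_zero_of_orthogonal [Module.Free ℤ L] [Module.Finite ℤ L] {n : ℕ}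
    {B : LinearMap.BilinForm ℤ L} {h : Fin n → L} (hrank : Module.finrank ℤ L = n)
    (hh : ∀ i j, i ≠ j → B (h i) (h j) = 0) (h0 : ∀ i, B (h i) (h i) ≠ 0) {r : L}
    (hr : ∀ i, B r (h i) = 0) : B r = 0 := by
  by_contra hne
  have h1 := finrank_ker_add_one hne
  have h2 : LinearIndependent ℤ (fun i => (⟨h i, hr i⟩ : LinearMap.ker (B r))) :=
    LinearIndependent.of_comp (LinearMap.ker (B r)).subtype
      (linearIndependent_of_orthogonal hh h0)
  have h3 := h2.fintype_card_le_finrank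
  rw [Fintype.card_fin] at h3
  omega

end

/-- The vectors of `ℤⁿ` whose coordinates have the same parity and a sum divisible by `4`. For the
form `(∑ εᵢ xᵢ²) / 4` this is the lattice `Dₙ⁺`, which is even and unimodular when the signature
`∑ εᵢ` is divisible by `8`. -/
def evenCoords (n : ℕ) : Submodule ℤ (Fin n → ℤ) where
  carrier := {α | (∀ i j, 2 ∣ α i - α j) ∧ 4 ∣ ∑ i, α i}
  add_mem' := by
    rintro α β ⟨h1, h2⟩ ⟨h3, h4⟩
    refine ⟨fun i j => ?_, ?_⟩
    · have : (α + β) i - (α + β) j = (α i - α j) + (β i - β j) := by simp; ring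
      rw [this]
      exact dvd_add (h1 i j) (h3 i j)
    · simp only [Pi.add_apply, Finset.sum_add_distrib]
      exact dvd_add h2 h4
  zero_mem' := by simp
  smul_mem' := by
    rintro c α ⟨h1, h2⟩
    refine ⟨fun i j => ?_, ?_⟩
    · have : (c • α) i - (c • α) j = c * (α i - α j) := by simp; ring
      rw [this]
      exact (h1 i j).mul_left c
    · simp only [Pi.smul_apply, smul_eq_mul, ← Finset.mul_sum]
      exact h2.mul_left c

/-- The evenness of `Dₙ⁺` for `8 ∣ n`, with the sum of squares replaced by a diagonal form with
entries `± 1` and signature divisible by `8`. -/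
theorem eight_dvd_sum_sq {n : ℕ} {ε : Fin n → ℤ} (hε : ∀ i, ε i = 1 ∨ ε i = -1)
    (h8 : 8 ∣ ∑ i, ε i) {α : Fin n → ℤ} (hα : α ∈ evenCoords n) :
    8 ∣ ∑ i, ε i * α i ^ 2 := by
  obtain ⟨h1, h2⟩ := hα
  by_cases hodd : ∃ i, Odd (α i)
  · obtain ⟨i, hi⟩ := hodd
    have hall : ∀ j, (8 : ℤ) ∣ ε j * α j ^ 2 - ε j := fun j => by
      have hj : Odd (α j) := by
        have := h1 i j
        rw [Int.odd_iff] at hi ⊢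
        omega
      have h3 : (8 : ℤ) ∣ α j ^ 2 - 1 := Int.eight_dvd_sq_sub_one_of_odd hj
      have h4 : ε j * α j ^ 2 - ε j = ε j * (α j ^ 2 - 1) := by ring
      rw [h4]
      exact h3.mul_left _
    have h5 := Finset.dvd_sum fun j (_ : j ∈ Finset.univ) => hall j
    rw [Finset.sum_sub_distrib] at h5
    exact (dvd_sub_left h8).mp h5
  · push Not at hodd
    have h3 : ∀ i, ∃ a, α i = 2 * a := fun i =>
      even_iff_two_dvd.mp (Int.not_odd_iff_even.mp (hodd i))
    choose a ha using h3
    have h4 : (2 : ℤ) ∣ ∑ i, a i := by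
      simp only [ha, ← Finset.mul_sum] at h2
      omega
    have h5 : ∀ i, (2 : ℤ) ∣ ε i * a i ^ 2 - a i := fun i => by
      rw [← even_iff_two_dvd]
      obtain h | h := hε i <;> rw [h] <;> simp [parity_simps]
    have h6 := Finset.dvd_sum fun j (_ : j ∈ Finset.univ) => h5 j
    rw [Finset.sum_sub_distrib] at h6
    obtain ⟨c, hc⟩ := (dvd_sub_left h4).mp h6
    refine ⟨c, ?_⟩
    simp only [ha]
    rw [show (8 : ℤ) * c = 4 * (2 * c) by ring, ← hc, Finset.mul_sum]
    exact Finset.sum_congr rfl fun i _ => by ring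

section
variable {L : Type*} [AddCommGroup L] {B : LinearMap.BilinForm ℤ L} {D : ℤ}

/-- A functional on a sublattice `W ⊇ D L` is the pairing with `x / D²`, for some vector `x` of
`L`, as soon as `D L* ⊆ L`. -/
theorem ScalesDual.exists_apply_eq_sq_mul (hD : ScalesDual B D)
    {W : Submodule ℤ L} (hW : ∀ l, D • l ∈ W) (φ : W →ₗ[ℤ] ℤ) :
    ∃ x, (∀ l, B x l = D * φ ⟨D • l, hW l⟩) ∧ ∀ y : W, B x y = D ^ 2 * φ y := by
  let p : L →ₗ[ℤ] W := LinearMap.codRestrict W (D • LinearMap.id) hW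
  obtain ⟨x, hx⟩ := hD (φ ∘ₗ p)
  refine ⟨x, hx, fun y => ?_⟩
  have h1 : p y = D • y := rfl
  rw [hx, LinearMap.comp_apply, h1, map_smul, smul_eq_mul]
  ring

/-- The vectors `x` such that `x / D` lies in the dual lattice. -/
def scaledDual (B : LinearMap.BilinForm ℤ L) (D : ℤ) : Submodule ℤ L where
  carrier := {x | ∀ y, D ∣ B x y}
  add_mem' := fun h1 h2 y => by
    rw [map_add, LinearMap.add_apply]
    exact dvd_add (h1 y) (h2 y)
  zero_mem' := by simp
  smul_mem' := fun c x h y => by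
    rw [map_smul, LinearMap.smul_apply]
    exact (h y).mul_left c

/-- A unimodular lattice `N / D` in the rational space of `L` yields the unimodular lattice
`L + (L* ∩ N / D)`: its dual is `L* ∩ (L + N / D)`, which is the same lattice by the modular law.
Everything is scaled by `D` so as to take place inside `L`. -/
theorem scalesDual_sup_inf [Module.Free ℤ L] [Module.Finite ℤ L] (hB : B.IsSymm) (hD0 : D ≠ 0)
    (hD : ScalesDual B D) {N : Submodule ℤ L}
    (hN : ∀ w, (∀ n ∈ N, D ^ 2 ∣ B w n) → w ∈ N) {M : Submodule ℤ L}
    (hM : M = LinearMap.range (D • LinearMap.id : L →ₗ[ℤ] L) ⊔ N ⊓ scaledDual B D)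
    (φ : M →ₗ[ℤ] ℤ) : ∃ x : M, ∀ y : M, B x y = D ^ 2 * φ y := by
  have hDM : ∀ l, D • l ∈ M := fun l => by
    rw [hM]
    exact Submodule.mem_sup_left ⟨l, rfl⟩
  obtain ⟨x, hx, hxM⟩ := hD.exists_apply_eq_sq_mul hDM φ
  suffices hmem : x ∈ M from ⟨⟨x, hmem⟩, hxM⟩
  set W : Submodule ℤ L := LinearMap.range (D • LinearMap.id : L →ₗ[ℤ] L) ⊔ N with hWdef
  have hDW : ∀ l, D • l ∈ W := fun l => Submodule.mem_sup_left ⟨l, rfl⟩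
  -- `x` lies in `W`, as its coordinates in a basis of `W`, being pairings with the dual basis,
  -- are integers
  have hxW : x ∈ W := by
    let b := Module.Free.chooseBasis ℤ W
    have hc : ∀ i, ∃ c, b.repr ⟨D • x, hDW x⟩ i = D * c := fun i => by
      obtain ⟨w, hw, hwW⟩ := hD.exists_apply_eq_sq_mul hDW (b.coord i)
      have hwN : w ∈ N := hN w fun n hn =>
        ⟨_, hwW ⟨n, Submodule.mem_sup_right hn⟩⟩
      have hwM : w ∈ M := by
        rw [hM]
        exact Submodule.mem_sup_right ⟨hwN, fun y => ⟨_, hw y⟩⟩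
      refine ⟨φ ⟨w, hwM⟩, mul_left_cancel₀ hD0 ?_⟩
      have h1 := hxM ⟨w, hwM⟩
      rw [hB.eq] at h1
      have h2 := (hw x).symm.trans h1
      rw [Module.Basis.coord_apply] at h2
      rw [h2]
      ring
    choose c hc using hc
    have h1 : (⟨D • x, hDW x⟩ : W) = D • ∑ i, c i • b i := by
      rw [← b.sum_repr ⟨D • x, hDW x⟩, Finset.smul_sum]
      exact Finset.sum_congr rfl fun i _ => by rw [hc, mul_smul]
    have h2 : D • x = D • ((∑ i, c i • b i : W) : L) := congrArg Subtype.val h1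
    rw [smul_right_injective L hD0 h2]
    exact Subtype.property _
  obtain ⟨-, ⟨l, rfl⟩, n, hn, hln⟩ := Submodule.mem_sup.mp hxW
  rw [hM, ← hln]
  refine Submodule.add_mem_sup ⟨l, rfl⟩ ⟨hn, fun y => ?_⟩
  have h1 : B n y = B x y - D * B l y := by
    rw [← hln]
    simp
  rw [h1, hx]
  exact dvd_sub (dvd_mul_right _ _) (dvd_mul_right _ _)

end

/-- A lattice which is rationally a sum of forms `⟨1⟩` and `⟨-1⟩`, of signature divisible by `8`,
is contained in an even unimodular lattice, if it is even. The latter is realized as a sublattice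
`M` of `L`, with the form divided by `D²`, into which `L` embeds by `l ↦ D l`. -/
theorem exists_even_unimodular_overlattice {L : Type*} [AddCommGroup L] [Module.Free ℤ L]
    [Module.Finite ℤ L] {B : LinearMap.BilinForm ℤ L} (hB : B.IsSymm)
    (hnd : ∀ x, B x = 0 → x = 0) (heven : ∀ x, Even (B x x)) {n : ℕ}
    (hrank : Module.finrank ℤ L = n) {ε : Fin n → ℤ} (hε : ∀ i, ε i = 1 ∨ ε i = -1)
    (h8 : 8 ∣ ∑ i, ε i) {H : ℤ} (hH : H ≠ 0) {h : Fin n → L}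
    (hh : ∀ i j, B (h i) (h j) = if i = j then ε i * H ^ 2 else 0)
    (hD : ScalesDual B (2 * H)) :
    ∃ (M : Submodule ℤ L) (C : LinearMap.BilinForm ℤ M),
      (∀ x y : M, (2 * H) ^ 2 * C x y = B x y) ∧ (∀ l : L, (2 * H) • l ∈ M) ∧
      (∀ x, Even (C x x)) ∧ ScalesDual C 1 := by
  set D : ℤ := 2 * H with hDdef
  have hD0 : D ≠ 0 := mul_ne_zero two_ne_zero hH
  have hε2 : ∀ i, ε i * ε i = 1 := fun i => by obtain h | h := hε i <;> rw [h] <;> rfl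
  have hortho : ∀ i j, i ≠ j → B (h i) (h j) = 0 := fun i j hij => by rw [hh, if_neg hij]
  have hne : ∀ i, B (h i) (h i) ≠ 0 := fun i => by
    rw [hh, if_pos rfl]
    refine mul_ne_zero ?_ (pow_ne_zero 2 hH)
    obtain h | h := hε i <;> rw [h] <;> norm_num
  set T := Fintype.linearCombination ℤ h with hT
  have hTh : ∀ α i, B (T α) (h i) = ε i * α i * H ^ 2 := fun α i => by
    rw [hT, Fintype.linearCombination_apply]
    simp only [map_sum, LinearMap.sum_apply, map_smul, LinearMap.smul_apply, smul_eq_mul, hh]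
    rw [Finset.sum_eq_single i (fun j _ hij => by rw [if_neg hij, mul_zero]) (by simp), if_pos rfl]
    ring
  have hTT : ∀ x α, B x (T α) = ∑ i, α i * B x (h i) := fun x α => by
    rw [hT, Fintype.linearCombination_apply]
    simp
  set N : Submodule ℤ L := (evenCoords n).map T with hNdef
  have hNnorm : ∀ x ∈ N, 2 * D ^ 2 ∣ B x x := by
    rintro - ⟨α, hα, rfl⟩
    obtain ⟨c, hc⟩ := eight_dvd_sum_sq hε h8 hα
    refine ⟨c, ?_⟩
    calc B (T α) (T α) = H ^ 2 * ∑ i, ε i * α i ^ 2 := by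
          rw [hTT, Finset.mul_sum]
          exact Finset.sum_congr rfl fun i _ => by rw [hTh]; ring
      _ = 2 * D ^ 2 * c := by rw [hc, hDdef]; ring
  have hNdual : ∀ w, (∀ x ∈ N, D ^ 2 ∣ B w x) → w ∈ N := by
    intro w hw
    have hD2 : D ^ 2 = H ^ 2 * 4 := by rw [hDdef]; ring
    have h1 : ∀ α ∈ evenCoords n, H ^ 2 * 4 ∣ ∑ i, α i * B w (h i) := fun α hα => by
      rw [← hTT, ← hD2]
      exact hw _ ⟨α, hα, rfl⟩
    have h2 : ∀ i, ∃ β, B w (h i) = H ^ 2 * (ε i * β) := fun i => by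
      have h3 := h1 (Pi.single i 4) ⟨fun j l => by
        simp only [Pi.single_apply]
        split_ifs <;> norm_num, by simp⟩
      simp only [Pi.single_apply, ite_mul, zero_mul, Finset.sum_ite_eq', Finset.mem_univ,
        if_true, mul_comm (4 : ℤ)] at h3
      obtain ⟨β, hβ⟩ := Int.dvd_of_mul_dvd_mul_right (by norm_num) h3
      exact ⟨ε i * β, by rw [hβ, ← mul_assoc (ε i), hε2, one_mul]⟩
    choose β hβ using h2
    have hH2 : H ^ 2 ≠ 0 := pow_ne_zero 2 hH
    have h3 : ∀ α ∈ evenCoords n, 4 ∣ ∑ i, α i * (ε i * β i) := fun α hα => by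
      have h4 := h1 α hα
      have h5 : ∑ i, α i * B w (h i) = H ^ 2 * ∑ i, α i * (ε i * β i) := by
        rw [Finset.mul_sum]
        exact Finset.sum_congr rfl fun i _ => by rw [hβ]; ring
      rw [h5] at h4
      exact Int.dvd_of_mul_dvd_mul_left hH2 h4
    have hβmem : β ∈ evenCoords n := by
      refine ⟨fun i j => ?_, ?_⟩
      · rcases eq_or_ne i j with rfl | hij
        · simp
        have h4 := h3 (Pi.single i 2 - Pi.single j 2) ⟨fun k l => by
          simp only [Pi.sub_apply, Pi.single_apply]
          split_ifs <;> norm_num, by simp⟩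
        simp only [Pi.sub_apply, Pi.single_apply, sub_mul, ite_mul, zero_mul,
          Finset.sum_sub_distrib, Finset.sum_ite_eq', Finset.mem_univ, if_true] at h4
        obtain h5 | h5 := hε i <;> obtain h6 | h6 := hε j <;> rw [h5, h6] at h4 <;> omega
      · have h4 := h3 ε ⟨fun i j => by
          obtain h5 | h5 := hε i <;> obtain h6 | h6 := hε j <;> rw [h5, h6] <;> norm_num,
          dvd_trans (by norm_num) h8⟩
        simpa only [← mul_assoc, hε2, one_mul] using h4
    refine ⟨β, hβmem, ?_⟩
    refine (sub_eq_zero.mp (hnd _ ?_)).symm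
    refine apply_eq_zero_of_orthogonal hrank hortho hne fun i => ?_
    rw [map_sub, LinearMap.sub_apply, hTh, hβ]
    ring
  set M : Submodule ℤ L := LinearMap.range (D • LinearMap.id : L →ₗ[ℤ] L) ⊔ N ⊓ scaledDual B D
    with hM
  have hnorm : ∀ x ∈ M, 2 * D ^ 2 ∣ B x x := by
    intro x hx
    obtain ⟨-, ⟨l, rfl⟩, y, ⟨hyN, hyD⟩, rfl⟩ := Submodule.mem_sup.mp hx
    obtain ⟨a, ha⟩ := hNnorm y hyN
    obtain ⟨b, hb⟩ := hyD l
    obtain ⟨c, hc⟩ := heven l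
    refine ⟨a + b + c, ?_⟩
    simp only [LinearMap.smul_apply, LinearMap.id_apply, map_add, map_smul, LinearMap.add_apply,
      smul_eq_mul, hB.eq l y, ha, hb, hc]
    ring
  have hdvd : ∀ x y : M, D ^ 2 ∣ B x y := fun x y => by
    have h1 := hnorm _ (x + y).2
    have h2 : B (x + y : M) (x + y : M) = B x x + B y y + 2 * B x y := by
      simp only [Submodule.coe_add, map_add, LinearMap.add_apply, hB.eq (y : L) x]
      ring
    rw [h2] at h1
    exact Int.dvd_of_mul_dvd_mul_left two_ne_zero
      ((dvd_add_right (dvd_add (hnorm _ x.2) (hnorm _ y.2))).mp h1)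
  choose c hc using hdvd
  have hD2 : D ^ 2 ≠ 0 := pow_ne_zero 2 hD0
  let C : LinearMap.BilinForm ℤ M := LinearMap.mk₂ ℤ c
    (fun x y z => mul_left_cancel₀ hD2 (by rw [mul_add, ← hc, ← hc, ← hc]; simp))
    (fun a x y => mul_left_cancel₀ hD2 (by
      rw [smul_eq_mul, mul_left_comm, ← hc, ← hc]; simp))
    (fun x y z => mul_left_cancel₀ hD2 (by rw [mul_add, ← hc, ← hc, ← hc]; simp))
    (fun a x y => mul_left_cancel₀ hD2 (by
      rw [smul_eq_mul, mul_left_comm, ← hc, ← hc]; simp))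
  have hC : ∀ x y, D ^ 2 * C x y = B x y := fun x y => (hc x y).symm
  refine ⟨M, C, hC, fun l => Submodule.mem_sup_left ⟨l, rfl⟩, fun x => ?_, fun φ => ?_⟩
  · have h1 := hnorm _ x.2
    rw [← hC, mul_comm (2 : ℤ)] at h1
    exact even_iff_two_dvd.mpr (Int.dvd_of_mul_dvd_mul_left hD2 h1)
  · obtain ⟨x, hx⟩ := scalesDual_sup_inf hB hD0 hD hNdual hM φ
    exact ⟨x, fun y => mul_left_cancel₀ hD2 (by rw [hC, hx, one_mul])⟩

/-! ### Hyperbolic lattices and odd unimodular lattices -/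

section
variable {L : Type*} [AddCommGroup L] {B : LinearMap.BilinForm ℤ L}

/-- A hyperbolic form: it takes a positive value and is negative definite on the orthogonal
complement of every vector of positive norm. For a nondegenerate form of rank `n + 1` this says
that the signature is `(1, n)`. -/
def IsLorentzian (B : LinearMap.BilinForm ℤ L) : Prop :=
  (∃ u, 0 < B u u) ∧ ∀ x y, 0 < B x x → B x y = 0 → y ≠ 0 → B y y < 0

/-- It suffices that a single vector of positive norm has a negative definite orthogonal
complement. -/
theorem isLorentzian_of_pos (hB : B.IsSymm) {u : L} (hu : 0 < B u u)
    (hneg : ∀ y, B u y = 0 → y ≠ 0 → B y y < 0) : IsLorentzian B := by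
  refine ⟨⟨u, hu⟩, fun x y hx hxy hy => ?_⟩
  by_contra! hyy
  -- a combination of `x` and `y` orthogonal to `u`
  set z := B u y • x - B u x • y with hz
  have hzz : B z z = B u y ^ 2 * B x x + B u x ^ 2 * B y y := by
    simp only [hz, map_sub, map_smul, LinearMap.sub_apply, LinearMap.smul_apply, smul_eq_mul,
      hB.eq y x, hxy]
    ring
  have huz : B u z = 0 := by
    simp only [hz, map_sub, map_smul, smul_eq_mul]
    ring
  have hz0 : z = 0 := by
    by_contra h
    have := hneg z huz h
    nlinarith [mul_nonneg (sq_nonneg (B u y)) hx.le, mul_nonneg (sq_nonneg (B u x)) hyy]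
  rw [hz0, map_zero] at hzz
  have huy : B u y = 0 := by
    have h1 : B u y ^ 2 * B x x = 0 := by
      have h1 := mul_nonneg (sq_nonneg (B u y)) hx.le
      have h2 := mul_nonneg (sq_nonneg (B u x)) hyy
      linarith
    simpa [hx.ne'] using h1
  exact absurd (hneg y huy hy) (not_lt.mpr hyy)

theorem IsLorentzian.restrict (h : IsLorentzian B) {W : Submodule ℤ L} {u : L} (hu : u ∈ W)
    (hpos : 0 < B u u) : IsLorentzian (B.restrict W) :=
  ⟨⟨⟨u, hu⟩, hpos⟩, fun x y hx hxy hy => h.2 x y hx hxy fun h0 => hy (Subtype.ext h0)⟩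

/-- A lattice with `c L* ⊆ L` is nondegenerate. -/
theorem ScalesDual.eq_zero [Module.Free ℤ L] (hB : B.IsSymm) {c : ℤ} (hc0 : c ≠ 0)
    (hc : ScalesDual B c) {x : L} (hx : B x = 0) : x = 0 := by
  let b := Module.Free.chooseBasis ℤ L
  refine b.ext_elem fun i => ?_
  obtain ⟨y, hy⟩ := hc (b.coord i)
  have h1 := hy x
  rw [hB.eq, hx, LinearMap.zero_apply, eq_comm, mul_eq_zero] at h1
  simpa using h1.resolve_left hc0

/-- Parseval's identity for an orthogonal family of maximal length. -/
theorem mul_apply_eq_sum [Module.Free ℤ L] [Module.Finite ℤ L] (hB : B.IsSymm) {n : ℕ}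
    (hrank : Module.finrank ℤ L = n) {ε : Fin n → ℤ} (hε : ∀ i, ε i = 1 ∨ ε i = -1) {c : ℤ}
    (hc : c ≠ 0) {h : Fin n → L} (hh : ∀ i j, B (h i) (h j) = if i = j then ε i * c else 0)
    (x y : L) : c * B x y = ∑ i, ε i * B x (h i) * B y (h i) := by
  have hε2 : ∀ i, ε i * ε i = 1 := fun i => by obtain h | h := hε i <;> rw [h] <;> rfl
  set r := c • x - ∑ i, (ε i * B x (h i)) • h i with hr
  have hr0 : B r = 0 := by
    refine apply_eq_zero_of_orthogonal (B := B) (h := h) hrank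
      (fun i j hij => by rw [hh, if_neg hij]) (fun i => ?_) fun j => ?_
    · rw [hh, if_pos rfl]
      refine mul_ne_zero ?_ hc
      obtain h | h := hε i <;> rw [h] <;> norm_num
    · simp only [hr, map_sub, map_smul, map_sum, LinearMap.sub_apply, LinearMap.smul_apply,
        LinearMap.sum_apply, smul_eq_mul, hh]
      rw [Finset.sum_eq_single j (fun i _ hij => by rw [if_neg hij, mul_zero]) (by simp),
        if_pos rfl]
      linear_combination (-c * B x (h j)) * hε2 j
  have h1 := LinearMap.congr_fun hr0 y
  simp only [hr, map_sub, map_smul, map_sum, LinearMap.sub_apply, LinearMap.smul_apply,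
    LinearMap.sum_apply, smul_eq_mul, LinearMap.zero_apply, sub_eq_zero] at h1
  rw [h1]
  exact Finset.sum_congr rfl fun i _ => by rw [hB.eq (h i) y]

theorem natAbs_det_eq_one {n : ℕ} (hB : B.IsSymm) (b : Module.Basis (Fin n) ℤ L)
    (hp : ScalesDual B 1) : (LinearMap.BilinForm.toMatrix b B).det.natAbs = 1 := by
  obtain ⟨d, hd⟩ := exists_det_mul_eq_pow hB b hp
  rw [one_pow] at hd
  exact Int.isUnit_iff_natAbs_eq.mp (IsUnit.of_mul_eq_one d hd)

end

theorem exists_isotropic {L : Type u} [AddCommGroup L] [Module.Free ℤ L] [Module.Finite ℤ L]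
    {B : LinearMap.BilinForm ℤ L} (hB : B.IsSymm) (hp : ScalesDual B 1) (hlor : IsLorentzian B) {n : ℕ}
    (hrank : Module.finrank ℤ L = n + 2) (h18 : n + 2 ≤ 18) : ∃ e, e ≠ 0 ∧ B e e = 0 := by
  let b := Module.finBasisOfFinrankEq ℤ L hrank
  obtain ⟨K, h, ε, hε, hh⟩ := exists_orthogonal_frame (n := n + 1) h18 hB b (k := 0)
    (by rw [natAbs_det_eq_one hB b hp, pow_zero])
  have h4 : (0 : ℤ) < 4 ^ K := by positivity
  have hne : ∀ i, h i ≠ 0 := fun i h0 => by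
    have := hh i i
    rw [h0, map_zero, if_pos rfl] at this
    obtain h | h := hε i <;> rw [h] at this <;> omega
  obtain ⟨i, hi⟩ : ∃ i, ε i = 1 := by
    by_contra! hcon
    obtain ⟨u, hu⟩ := hlor.1
    have h1 := mul_apply_eq_sum hB hrank hε h4.ne' hh u u
    have h2 : ∑ i, ε i * B u (h i) * B u (h i) ≤ 0 := Finset.sum_nonpos fun i _ => by
      rw [(hε i).resolve_left (hcon i)]
      nlinarith [mul_self_nonneg (B u (h i))]
    nlinarith
  obtain ⟨j, hj⟩ : ∃ j, ε j = -1 := by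
    by_contra! hcon
    have hpos : ∀ i, 0 < B (h i) (h i) := fun i => by
      rw [hh, if_pos rfl, (hε i).resolve_right (hcon i), one_mul]
      exact h4
    have h01 : (0 : Fin (n + 2)) ≠ 1 := by simp
    have := hlor.2 (h 0) (h 1) (hpos 0) (by rw [hh, if_neg h01]) (hne 1)
    exact absurd this (not_lt.mpr (hpos 1).le)
  have hij : i ≠ j := by
    rintro rfl
    omega
  have hii : B (h i) (h i) = 4 ^ K := by rw [hh, if_pos rfl, hi, one_mul]
  have hjj : B (h j) (h j) = -4 ^ K := by rw [hh, if_pos rfl, hj]; ring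
  have hij' : B (h i) (h j) = 0 := by rw [hh, if_neg hij]
  have hji' : B (h j) (h i) = 0 := by rw [hh, if_neg hij.symm]
  refine ⟨h i + h j, fun h0 => ?_, by simp [hii, hjj, hij', hji']⟩
  have h1 : B (h i + h j) (h i) = 4 ^ K := by simp [hii, hji']
  rw [h0, map_zero, LinearMap.zero_apply] at h1
  omega

/-- In a unimodular lattice, an isotropic vector is a multiple of a vector `e` that belongs to a
pair with `(e, e) = 0` and `(e, f) = 1`. -/
theorem exists_hyperbolic_pair {L : Type*} [AddCommGroup L] [Module.Free ℤ L]
    {B : LinearMap.BilinForm ℤ L} (hB : B.IsSymm) (hp : ScalesDual B 1) {e₀ : L} (h0 : e₀ ≠ 0)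
    (hiso : B e₀ e₀ = 0) : ∃ e f, B e e = 0 ∧ B e f = 1 := by
  obtain ⟨g, hg⟩ := IsPrincipalIdealRing.principal (LinearMap.range (B e₀))
  have hdvd : ∀ y, ∃ c, B e₀ y = g * c := fun y =>
    Ideal.mem_span_singleton.mp (show B e₀ y ∈ Ideal.span {g} by
      rw [← show LinearMap.range (B e₀) = Ideal.span {g} from hg]
      exact ⟨y, rfl⟩)
  have hg0 : g ≠ 0 := by
    rintro rfl
    refine h0 (hp.eq_zero hB one_ne_zero (LinearMap.ext fun y => ?_))
    obtain ⟨c, hc⟩ := hdvd y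
    rw [hc, zero_mul, LinearMap.zero_apply]
  choose c hc using hdvd
  let φ : L →ₗ[ℤ] ℤ :=
    { toFun := c
      map_add' := fun x y => mul_left_cancel₀ hg0 (by rw [mul_add, ← hc, ← hc, ← hc, map_add])
      map_smul' := fun a x => mul_left_cancel₀ hg0 (by
        rw [← hc, map_smul, hc, smul_eq_mul, smul_eq_mul, RingHom.id_apply]; ring) }
  obtain ⟨e, he⟩ := hp φ
  have hge : g • e = e₀ := by
    refine sub_eq_zero.mp (hp.eq_zero hB one_ne_zero (LinearMap.ext fun y => ?_))
    rw [map_sub, map_smul, LinearMap.sub_apply, LinearMap.smul_apply, he, hc, one_mul]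
    exact sub_self _
  obtain ⟨f, hf⟩ : g ∈ LinearMap.range (B e₀) := by
    rw [hg]
    exact Submodule.mem_span_singleton_self g
  refine ⟨e, f, ?_, ?_⟩
  · rw [← hge] at hiso
    simpa [hg0] using hiso
  · refine mul_left_cancel₀ hg0 ?_
    rw [← smul_eq_mul, ← LinearMap.smul_apply, ← map_smul, hge, hf, mul_one]

/-- The signs of the form `-x₀² - ⋯ - xₙ₋₁² + xₙ²`. -/
def lorentzSign (n : ℕ) (i : Fin (n + 1)) : ℤ := if i = Fin.last n then 1 else -1

theorem lorentzSign_eq (n : ℕ) (i : Fin (n + 1)) : lorentzSign n i = 1 ∨ lorentzSign n i = -1 := by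
  unfold lorentzSign
  split_ifs <;> simp

/-- An odd unimodular lattice of signature `(1, n)`, where `n ≤ 17`, has an orthonormal basis. An
isotropic vector gives a pair `u`, `v` of orthogonal vectors of norms `1` and `-1`, and the
complement of `v` is again odd, since it contains `u`. -/
theorem exists_orthonormal_of_odd (n : ℕ) (h18 : n + 1 ≤ 18) :
    ∀ {L : Type u} [AddCommGroup L] [Module.Free ℤ L] [Module.Finite ℤ L]
      {B : LinearMap.BilinForm ℤ L}, B.IsSymm → ScalesDual B 1 → IsLorentzian B →
      (∃ t, Odd (B t t)) → Module.finrank ℤ L = n + 1 →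
      ∃ b : Fin (n + 1) → L, ∀ i j, B (b i) (b j) = if i = j then lorentzSign n i * 1 else 0 := by
  induction n with
  | zero =>
    intro L _ _ _ B hB hp hlor _ hrank
    let b := Module.finBasisOfFinrankEq ℤ L hrank
    have h1 := natAbs_det_eq_one hB b hp
    have h2 : (LinearMap.BilinForm.toMatrix b B).det = B (b 0) (b 0) := by
      rw [det_fin_one, LinearMap.BilinForm.toMatrix_apply]
    rw [h2] at h1
    obtain ⟨w, hw⟩ := hlor.1
    have h3 : w = b.repr w 0 • b 0 := by
      conv_lhs => rw [← b.sum_repr w]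
      simp
    rw [h3] at hw
    simp only [map_smul, LinearMap.smul_apply, smul_eq_mul] at hw
    have h4 : B (b 0) (b 0) = 1 := by
      obtain h | h := Int.natAbs_eq_iff.mp h1
      · exact h
      · rw [h] at hw
        push_cast at hw
        nlinarith [mul_self_nonneg (b.repr w 0)]
    refine ⟨b, fun i j => ?_⟩
    obtain rfl : i = 0 := Fin.ext (by omega)
    obtain rfl : j = 0 := Fin.ext (by omega)
    rw [h4]
    simp [lorentzSign]
  | succ n ih =>
    intro L _ _ _ B hB hp hlor ⟨t, ht⟩ hrank
    obtain ⟨e₀, he₀, hiso⟩ := exists_isotropic hB hp hlor hrank h18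
    obtain ⟨e, f, hee, hef⟩ := exists_hyperbolic_pair hB hp he₀ hiso
    -- `f` can be chosen of odd norm, and then corrected to norm `1` by a multiple of `e`
    obtain ⟨f, hef, ⟨r, hr⟩⟩ : ∃ f, B e f = 1 ∧ Odd (B f f) := by
      obtain hf | hf := Int.even_or_odd (B f f)
      · refine ⟨t + (1 - B e t) • f, by simp [hef], ?_⟩
        have h1 : B (t + (1 - B e t) • f) (t + (1 - B e t) • f) =
            B t t + (2 * ((1 - B e t) * B t f) + (1 - B e t) ^ 2 * B f f) := by
          simp only [map_add, map_smul, LinearMap.add_apply, LinearMap.smul_apply, smul_eq_mul,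
            hB.eq f t]
          ring
        rw [h1]
        exact ht.add_even ((even_two_mul _).add (hf.mul_left _))
      · exact ⟨f, hef, hf⟩
    have hfe : B f e = 1 := by rw [hB.eq, hef]
    set w := f - r • e with hw
    set v := w - e with hv
    have hww : B w w = 1 := by
      simp only [hw, map_sub, map_smul, LinearMap.sub_apply, LinearMap.smul_apply, smul_eq_mul,
        hee, hef, hfe, hr]
      ring
    have hwe : B w e = 1 := by simp [hw, hee, hfe]
    have hew : B e w = 1 := by rw [hB.eq, hwe]
    have hvv : B v v = -1 := by
      simp only [hv, map_sub, LinearMap.sub_apply, hww, hwe, hew, hee]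
      norm_num
    have hvw : B v w = 0 := by
      simp only [hv, map_sub, LinearMap.sub_apply, hww, hew]
      norm_num
    have hv0 : B v ≠ 0 := by
      intro h
      rw [h] at hvv
      simp at hvv
    have hp' : ScalesDual (B.restrict (LinearMap.ker (B v))) 1 := by
      have := hp.restrict_ker v
      rwa [hvv, neg_one_sq, one_mul] at this
    obtain ⟨b, hb⟩ := ih (by omega) (isSymm_restrict hB _) hp'
      (hlor.restrict (u := w) hvw (by rw [hww]; norm_num))
      ⟨⟨w, hvw⟩, by rw [restrict_apply', hww]; exact odd_one⟩
      (by have := finrank_ker_add_one hv0; omega)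
    have hb' : ∀ i j, B (b i) (b j) = if i = j then lorentzSign n i * 1 else 0 := hb
    have hvb : ∀ i, B v (b i) = 0 := fun i => (b i).2
    refine ⟨Fin.cons v fun i => (b i : L), fun i j => ?_⟩
    induction i using Fin.cases with
    | zero =>
      induction j using Fin.cases with
      | zero => simp [hvv, lorentzSign, Fin.ext_iff]
      | succ j => simp [hvb, (Fin.succ_ne_zero j).symm]
    | succ i =>
      induction j using Fin.cases with
      | zero => simp [hB.eq _ v, hvb]
      | succ j => simp [hb', lorentzSign, Fin.ext_iff]

/-! ### Even unimodular hyperbolic lattices -/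

section
variable {N : Type*} [AddCommGroup N]

/-- The orthogonal sum of `⟨1⟩ ⊕ ⟨-1⟩` and a lattice `N`. -/
def oddForm (C : LinearMap.BilinForm ℤ N) : LinearMap.BilinForm ℤ (ℤ × ℤ × N) :=
  LinearMap.mk₂ ℤ (fun x y => x.1 * y.1 - x.2.1 * y.2.1 + C x.2.2 y.2.2)
    (fun x y z => by simp; ring) (fun c x y => by simp; ring)
    (fun x y z => by simp; ring) (fun c x y => by simp; ring)

theorem oddForm_apply (C : LinearMap.BilinForm ℤ N) (x y : ℤ × ℤ × N) :
    oddForm C x y = x.1 * y.1 - x.2.1 * y.2.1 + C x.2.2 y.2.2 := rfl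

theorem isSymm_oddForm {C : LinearMap.BilinForm ℤ N} (hC : C.IsSymm) : (oddForm C).IsSymm :=
  ⟨fun x y => by rw [oddForm_apply, oddForm_apply, hC.eq]; ring⟩

theorem scalesDual_oddForm {C : LinearMap.BilinForm ℤ N} (hC : ScalesDual C 1) :
    ScalesDual (oddForm C) 1 := fun φ => by
  obtain ⟨z, hz⟩ := hC (φ ∘ₗ LinearMap.inr ℤ ℤ (ℤ × N) ∘ₗ LinearMap.inr ℤ ℤ N)
  refine ⟨(φ (1, 0, 0), -φ (0, 1, 0), z), fun y => ?_⟩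
  have hy : y = y.1 • ((1, 0, 0) : ℤ × ℤ × N) + y.2.1 • ((0, 1, 0) : ℤ × ℤ × N) +
      (0, 0, y.2.2) := by
    ext <;> simp
  have h1 : φ y = y.1 * φ (1, 0, 0) + y.2.1 * φ (0, 1, 0) + φ (0, 0, y.2.2) := by
    conv_lhs => rw [hy]
    rw [map_add, map_add, map_smul, map_smul, smul_eq_mul, smul_eq_mul]
  rw [oddForm_apply, hz, h1]
  simp only [LinearMap.comp_apply, LinearMap.inr_apply]
  ring

theorem isLorentzian_oddForm {C : LinearMap.BilinForm ℤ N} (hC : C.IsSymm)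
    (hneg : ∀ y, y ≠ 0 → C y y < 0) : IsLorentzian (oddForm C) := by
  refine isLorentzian_of_pos (isSymm_oddForm hC) (u := (1, 0, 0)) (by simp [oddForm_apply]) ?_
  rintro ⟨a, b, z⟩ h1 h2
  have ha : a = 0 := by simpa [oddForm_apply] using h1
  subst ha
  rw [oddForm_apply]
  by_cases hz : z = 0
  · subst hz
    have hb : b ≠ 0 := by
      rintro rfl
      exact h2 rfl
    simpa using hb
  · have := hneg z hz
    simp only [mul_zero, zero_sub]
    nlinarith [mul_self_nonneg b]

/-- `U ⊕ N`, scaled by `2`, inside `⟨1⟩ ⊕ ⟨-1⟩ ⊕ N`: the standard basis of `U` is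
`u + v`, `(u - v) / 2`. -/
def doubleEmb (N : Type*) [AddCommGroup N] : (ℤ × ℤ × N) →ₗ[ℤ] (ℤ × ℤ × N) where
  toFun x := (2 * x.1 + x.2.1, 2 * x.1 - x.2.1, (2 : ℤ) • x.2.2)
  map_add' x y := by ext <;> simp <;> ring
  map_smul' c x := by ext <;> simp [smul_comm c] <;> ring

theorem doubleEmb_apply (x : ℤ × ℤ × N) :
    doubleEmb N x = (2 * x.1 + x.2.1, 2 * x.1 - x.2.1, (2 : ℤ) • x.2.2) := rfl

theorem mem_range_doubleEmb {x : ℤ × ℤ × N} (h1 : 4 ∣ x.1 + x.2.1)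
    (h2 : ∃ z, x.2.2 = (2 : ℤ) • z) : x ∈ LinearMap.range (doubleEmb N) := by
  obtain ⟨a, ha⟩ := h1
  obtain ⟨z, hz⟩ := h2
  refine ⟨(a, 2 * a - x.2.1, z), ?_⟩
  ext
  · simp [doubleEmb_apply]; linarith
  · simp [doubleEmb_apply]
  · simp [doubleEmb_apply, hz]

theorem oddForm_doubleEmb (C : LinearMap.BilinForm ℤ N) (x y : ℤ × ℤ × N) :
    oddForm C (doubleEmb N x) (doubleEmb N y) =
      4 * (x.1 * y.2.1 + x.2.1 * y.1 + C x.2.2 y.2.2) := by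
  simp only [oddForm_apply, doubleEmb_apply, map_smul, LinearMap.smul_apply, smul_eq_mul]
  ring

theorem injective_doubleEmb [Module.Free ℤ N] : Function.Injective (doubleEmb N) := by
  rw [← LinearMap.ker_eq_bot, LinearMap.ker_eq_bot']
  rintro ⟨a, b, z⟩ h
  simp only [doubleEmb_apply, Prod.mk_eq_zero] at h
  obtain ⟨h1, h2, h3⟩ := h
  have hz : z = 0 := (smul_eq_zero.mp h3).resolve_left two_ne_zero
  have ha : a = 0 := by omega
  have hb : b = 0 := by omega
  rw [ha, hb, hz]
  rfl

end

/-- Two lattices with orthogonal bases of the same norms are isometric. The isometry is given with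
its adjoint, which is its inverse. -/
theorem exists_isometry_adjoint {K₁ : Type*} {K₂ : Type*} [AddCommGroup K₁] [AddCommGroup K₂]
    [Module.Free ℤ K₁] [Module.Free ℤ K₂] [Module.Finite ℤ K₁] [Module.Finite ℤ K₂]
    {B₁ : LinearMap.BilinForm ℤ K₁} {B₂ : LinearMap.BilinForm ℤ K₂} (hB₁ : B₁.IsSymm)
    (hB₂ : B₂.IsSymm) {n : ℕ} (h₁ : Module.finrank ℤ K₁ = n) (h₂ : Module.finrank ℤ K₂ = n)
    {ε : Fin n → ℤ} (hε : ∀ i, ε i = 1 ∨ ε i = -1) {b₁ : Fin n → K₁} {b₂ : Fin n → K₂}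
    (hb₁ : ∀ i j, B₁ (b₁ i) (b₁ j) = if i = j then ε i * 1 else 0)
    (hb₂ : ∀ i j, B₂ (b₂ i) (b₂ j) = if i = j then ε i * 1 else 0) :
    ∃ (φ : K₁ →ₗ[ℤ] K₂) (ψ : K₂ →ₗ[ℤ] K₁), (∀ x y, B₂ (φ x) (φ y) = B₁ x y) ∧
      (∀ x y, B₁ (ψ x) (ψ y) = B₂ x y) ∧ ∀ x y, B₂ (φ x) y = B₁ x (ψ y) := by
  have hε2 : ∀ i, ε i * ε i = 1 := fun i => by obtain h | h := hε i <;> rw [h] <;> rfl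
  let φ : K₁ →ₗ[ℤ] K₂ := ∑ i, (ε i • B₁.flip (b₁ i)).smulRight (b₂ i)
  let ψ : K₂ →ₗ[ℤ] K₁ := ∑ i, (ε i • B₂.flip (b₂ i)).smulRight (b₁ i)
  have hφ : ∀ x y, B₂ (φ x) y = ∑ i, ε i * B₁ x (b₁ i) * B₂ y (b₂ i) := fun x y => by
    simp only [φ, LinearMap.sum_apply, LinearMap.smulRight_apply, LinearMap.smul_apply, map_sum,
      map_smul, smul_eq_mul]
    exact Finset.sum_congr rfl fun i _ => by rw [hB₂.eq y]; rfl
  have hψ : ∀ x y, B₁ (ψ x) y = ∑ i, ε i * B₂ x (b₂ i) * B₁ y (b₁ i) := fun x y => by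
    simp only [ψ, LinearMap.sum_apply, LinearMap.smulRight_apply, LinearMap.smul_apply, map_sum,
      map_smul, smul_eq_mul]
    exact Finset.sum_congr rfl fun i _ => by rw [hB₁.eq y]; rfl
  have hφb : ∀ x i, B₂ (φ x) (b₂ i) = B₁ x (b₁ i) := fun x i => by
    rw [hφ, Finset.sum_eq_single i (fun j _ hji => by rw [hb₂, if_neg hji.symm, mul_zero])
      (by simp), hb₂, if_pos rfl]
    linear_combination B₁ x (b₁ i) * hε2 i
  have hψb : ∀ x i, B₁ (ψ x) (b₁ i) = B₂ x (b₂ i) := fun x i => by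
    rw [hψ, Finset.sum_eq_single i (fun j _ hji => by rw [hb₁, if_neg hji.symm, mul_zero])
      (by simp), hb₁, if_pos rfl]
    linear_combination B₂ x (b₂ i) * hε2 i
  refine ⟨φ, ψ, fun x y => ?_, fun x y => ?_, fun x y => ?_⟩
  · have h := mul_apply_eq_sum hB₁ h₁ hε one_ne_zero hb₁ x y
    rw [one_mul] at h
    rw [hφ, h]
    simp only [hφb]
  · have h := mul_apply_eq_sum hB₂ h₂ hε one_ne_zero hb₂ x y
    rw [one_mul] at h
    rw [hψ, h]
    simp only [hψb]
  · rw [hφ, hB₁.eq, hψ]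
    exact Finset.sum_congr rfl fun i _ => by ring

/-- An even unimodular lattice of signature `(1, n + 1)` is `U ⊕ N`, where `N` is even, unimodular
and negative definite. -/
theorem exists_equiv_hyperbolic_sum {L : Type u} [AddCommGroup L] [Module.Free ℤ L]
    [Module.Finite ℤ L] {B : LinearMap.BilinForm ℤ L} (hB : B.IsSymm) (hp : ScalesDual B 1)
    (hlor : IsLorentzian B) (heven : ∀ x, Even (B x x)) {n : ℕ}
    (hrank : Module.finrank ℤ L = n + 2) (h18 : n + 2 ≤ 18) :
    ∃ (N : Submodule ℤ L) (C : LinearMap.BilinForm ℤ N) (E : L ≃ₗ[ℤ] ℤ × ℤ × N), C.IsSymm ∧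
      ScalesDual C 1 ∧ (∀ y, y ≠ 0 → C y y < 0) ∧ (∀ y, Even (C y y)) ∧
      ∀ x y, B x y = (E x).1 * (E y).2.1 + (E x).2.1 * (E y).1 + C (E x).2.2 (E y).2.2 := by
  obtain ⟨e₀, he₀, hiso⟩ := exists_isotropic hB hp hlor hrank h18
  obtain ⟨e, f₀, hee, hef₀⟩ := exists_hyperbolic_pair hB hp he₀ hiso
  obtain ⟨r, hr⟩ := heven f₀
  set f := f₀ - r • e with hf
  have hef : B e f = 1 := by simp [hf, hee, hef₀]
  have hfe : B f e = 1 := by rw [hB.eq, hef]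
  have hff : B f f = 0 := by
    simp only [hf, map_sub, map_smul, LinearMap.sub_apply, LinearMap.smul_apply, smul_eq_mul,
      hee, hef₀, hB.eq f₀ e, hr]
    ring
  let N : Submodule ℤ L := LinearMap.ker (B e) ⊓ LinearMap.ker (B f)
  have hNe : ∀ y : N, B e y = 0 := fun y => y.2.1
  have hNf : ∀ y : N, B f y = 0 := fun y => y.2.2
  let p : L →ₗ[ℤ] N := LinearMap.codRestrict N
    (LinearMap.id - (B f).smulRight e - (B e).smulRight f) fun x => by
      refine ⟨?_, ?_⟩ <;> simp [hee, hef, hfe, hff]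
  have hp' : ∀ x, (p x : L) = x - B f x • e - B e x • f := fun x => rfl
  let E : L ≃ₗ[ℤ] ℤ × ℤ × N :=
    { toFun := fun x => (B f x, B e x, p x)
      map_add' := fun x y => by simp
      map_smul' := fun c x => by simp
      invFun := fun x => x.1 • e + x.2.1 • f + x.2.2
      left_inv := fun x => by simp only [hp']; abel
      right_inv := fun x => by
        ext
        · simp [hff, hfe, hNf]
        · simp [hee, hef, hNe]
        · simp [hp', hff, hfe, hNf, hee, hef, hNe] }
  refine ⟨N, B.restrict N, E, isSymm_restrict hB N, fun φ => ?_, fun y hy => ?_,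
    fun y => heven y, fun x y => ?_⟩
  · obtain ⟨x, hx⟩ := hp (φ ∘ₗ p)
    refine ⟨p x, fun y => ?_⟩
    have h1 : p y = y := Subtype.ext (by simp [hp', hNe, hNf])
    have h2 := hx y
    rw [LinearMap.comp_apply, h1] at h2
    rw [restrict_apply', hp', ← h2]
    simp [hNe, hNf]
  · refine hlor.2 (e + f) y ?_ ?_ fun h => hy (Subtype.ext h)
    · simp [hee, hef, hfe, hff]
    · simp [hNe, hNf]
  · change B x y = B f x * B e y + B e x * B f y + B (p x) (p y)
    simp only [hp', map_sub, map_smul, LinearMap.sub_apply, LinearMap.smul_apply, smul_eq_mul,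
      hee, hef, hfe, hff, hB.eq x e, hB.eq x f]
    ring

/-- An isometric embedding of unimodular lattices of the same rank is an isometry. -/
theorem equivalent_of_isometric_embedding {L₁ : Type u} {L₂ : Type v} [AddCommGroup L₁]
    [AddCommGroup L₂] [Module.Free ℤ L₁] [Module.Free ℤ L₂] [Module.Finite ℤ L₁]
    [Module.Finite ℤ L₂] {B₁ : LinearMap.BilinForm ℤ L₁} {B₂ : LinearMap.BilinForm ℤ L₂}
    (hB₁ : B₁.IsSymm) (hB₂ : B₂.IsSymm) (hp₁ : ScalesDual B₁ 1) (hp₂ : ScalesDual B₂ 1)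
    (hrank : Module.finrank ℤ L₁ = Module.finrank ℤ L₂) (ψ : L₁ →ₗ[ℤ] L₂)
    (hψ : ∀ x y, B₂ (ψ x) (ψ y) = B₁ x y) : B₁.Equivalent B₂ := by
  have hinj : Function.Injective ψ := by
    rw [← LinearMap.ker_eq_bot, LinearMap.ker_eq_bot']
    intro x hx
    refine hp₁.eq_zero hB₁ one_ne_zero (LinearMap.ext fun y => ?_)
    rw [← hψ, hx, map_zero, LinearMap.zero_apply, LinearMap.zero_apply]
  have hsurj : Function.Surjective ψ := by
    intro y
    obtain ⟨x, hx⟩ := hp₁ (B₂ y ∘ₗ ψ)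
    refine ⟨x, (sub_eq_zero.mp (hp₂.eq_zero hB₂ one_ne_zero ?_)).symm⟩
    by_contra hne
    have h1 := finrank_ker_add_one hne
    have h2 : LinearMap.range ψ ≤ LinearMap.ker (B₂ (y - ψ x)) := by
      rintro - ⟨z, rfl⟩
      have := hx z
      rw [LinearMap.comp_apply, one_mul] at this
      rw [LinearMap.mem_ker, map_sub, LinearMap.sub_apply, hψ, this, sub_self]
    have h3 := Submodule.finrank_mono h2
    rw [LinearMap.finrank_range_of_inj hinj] at h3
    omega
  exact ⟨{ LinearEquiv.ofBijective ψ ⟨hinj, hsurj⟩ with map_app' := hψ }⟩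

/-- If every element is divisible by `4` under one of two integral functionals, then all elements
are, under the same one: a group is not the union of two proper subgroups. -/
theorem forall_four_dvd_or {L : Type*} [AddCommGroup L] {f g : L →ₗ[ℤ] ℤ}
    (h : ∀ x, 4 ∣ f x ∨ 4 ∣ g x) : (∀ x, 4 ∣ f x) ∨ ∀ x, 4 ∣ g x := by
  by_contra! hcon
  obtain ⟨⟨x, hx⟩, y, hy⟩ := hcon
  have h1 := (h x).resolve_left hx
  have h2 := (h y).resolve_right hy
  obtain h3 | h3 := h (x + y) <;> rw [map_add] at h3
  · exact hx ((dvd_add_left h2).mp h3)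
  · exact hy ((dvd_add_right h1).mp h3)

/-- The even unimodular lattices of signature `(1, n + 1)` with `n + 2 ≤ 18` are classified by
their rank. -/
theorem equivalent_of_even_unimodular {L₁ : Type u} {L₂ : Type v} [AddCommGroup L₁]
    [AddCommGroup L₂] [Module.Free ℤ L₁] [Module.Free ℤ L₂] [Module.Finite ℤ L₁]
    [Module.Finite ℤ L₂] {B₁ : LinearMap.BilinForm ℤ L₁} {B₂ : LinearMap.BilinForm ℤ L₂}
    (hB₁ : B₁.IsSymm) (hB₂ : B₂.IsSymm) (hp₁ : ScalesDual B₁ 1) (hp₂ : ScalesDual B₂ 1)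
    (hlor₁ : IsLorentzian B₁) (hlor₂ : IsLorentzian B₂) (he₁ : ∀ x, Even (B₁ x x))
    (he₂ : ∀ x, Even (B₂ x x)) {n : ℕ} (hr₁ : Module.finrank ℤ L₁ = n + 2)
    (hr₂ : Module.finrank ℤ L₂ = n + 2) (h18 : n + 2 ≤ 18) : B₁.Equivalent B₂ := by
  obtain ⟨N₁, C₁, E₁, hC₁, hCp₁, hneg₁, hCe₁, hE₁⟩ :=
    exists_equiv_hyperbolic_sum hB₁ hp₁ hlor₁ he₁ hr₁ h18
  obtain ⟨N₂, C₂, E₂, hC₂, hCp₂, hneg₂, hCe₂, hE₂⟩ :=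
    exists_equiv_hyperbolic_sum hB₂ hp₂ hlor₂ he₂ hr₂ h18
  have hk₁ : Module.finrank ℤ (ℤ × ℤ × N₁) = n + 1 + 1 := by rw [← E₁.finrank_eq, hr₁]
  have hk₂ : Module.finrank ℤ (ℤ × ℤ × N₂) = n + 1 + 1 := by rw [← E₂.finrank_eq, hr₂]
  obtain ⟨b₁, hb₁⟩ := exists_orthonormal_of_odd (n + 1) h18 (isSymm_oddForm hC₁)
    (scalesDual_oddForm hCp₁) (isLorentzian_oddForm hC₁ hneg₁)
    ⟨(1, 0, 0), by simp [oddForm_apply]⟩ hk₁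
  obtain ⟨b₂, hb₂⟩ := exists_orthonormal_of_odd (n + 1) h18 (isSymm_oddForm hC₂)
    (scalesDual_oddForm hCp₂) (isLorentzian_oddForm hC₂ hneg₂)
    ⟨(1, 0, 0), by simp [oddForm_apply]⟩ hk₂
  obtain ⟨φ, φ', hφ, hφ', hadj⟩ := exists_isometry_adjoint (isSymm_oddForm hC₁)
    (isSymm_oddForm hC₂) hk₁ hk₂ (lorentzSign_eq (n + 1)) hb₁ hb₂
  let θ : L₁ →ₗ[ℤ] ℤ × ℤ × N₂ := φ ∘ₗ doubleEmb N₁ ∘ₗ (E₁ : L₁ →ₗ[ℤ] ℤ × ℤ × N₁)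
  have hθ : ∀ x, θ x = φ (doubleEmb N₁ (E₁ x)) := fun x => rfl
  have hform : ∀ x y, oddForm C₂ (θ x) (θ y) = 4 * B₁ x y := fun x y => by
    rw [hθ, hθ, hφ, oddForm_doubleEmb, hE₁]
  -- the scaled copy of `U ⊕ N₁` pairs evenly with vectors of even norm; this is preserved by isometries
  have hpair : ∀ x k, Even (oddForm C₂ k k) → Even (oddForm C₂ (θ x) k) := fun x k hk => by
    rw [← hφ'] at hk
    rw [hθ, hadj]
    set l := φ' k
    rw [oddForm_apply] at hk ⊢
    rw [Int.even_add] at hk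
    have h1 : Even (l.1 * l.1 - l.2.1 * l.2.1) := hk.mpr (hCe₁ _)
    have h2 : Even (l.1 + l.2.1) := by
      simp only [Int.even_sub, Int.even_mul, or_self] at h1
      rw [Int.even_add]
      exact h1
    obtain ⟨c, hc⟩ := h2
    simp only [doubleEmb_apply, map_smul, LinearMap.smul_apply, smul_eq_mul]
    refine ⟨(E₁ x).1 * (l.1 - l.2.1) + (E₁ x).2.1 * c + C₁ (E₁ x).2.2 l.2.2, ?_⟩
    linear_combination (E₁ x).2.1 * hc
  have hθ1 : ∀ x, Even ((θ x).1 - (θ x).2.1) := fun x => by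
    have := hpair x (1, 1, 0) (by simp [oddForm_apply])
    simpa [oddForm_apply] using this
  have hθ2 : ∀ x, ∃ z, (θ x).2.2 = (2 : ℤ) • z := fun x => by
    have h1 : ∀ z, ∃ c, C₂ (θ x).2.2 z = 2 * c := fun z => by
      have := hpair x (0, 0, z) (by simpa [oddForm_apply] using hCe₂ z)
      exact even_iff_two_dvd.mp (by simpa [oddForm_apply] using this)
    choose c hc using h1
    let χ : N₂ →ₗ[ℤ] ℤ :=
      { toFun := c
        map_add' := fun a b => mul_left_cancel₀ (two_ne_zero (α := ℤ)) (by
          rw [mul_add, ← hc, ← hc, ← hc, map_add])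
        map_smul' := fun a b => mul_left_cancel₀ (two_ne_zero (α := ℤ)) (by
          rw [← hc, map_smul, hc, smul_eq_mul, smul_eq_mul, RingHom.id_apply]; ring) }
    obtain ⟨z, hz⟩ := hCp₂ χ
    refine ⟨z, sub_eq_zero.mp (hCp₂.eq_zero hC₂ one_ne_zero (LinearMap.ext fun y => ?_))⟩
    rw [map_sub, map_smul, LinearMap.sub_apply, LinearMap.smul_apply, hz, hc, one_mul]
    exact sub_self _
  have hθ3 : ∀ x, 4 ∣ (θ x).1 + (θ x).2.1 ∨ 4 ∣ (θ x).1 - (θ x).2.1 := fun x => by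
    obtain ⟨c, hc⟩ := he₁ x
    obtain ⟨z, hz⟩ := hθ2 x
    obtain ⟨d, hd⟩ := hCe₂ z
    have h1 := hform x x
    rw [oddForm_apply, hz, map_smul, map_smul, LinearMap.smul_apply, hc, hd] at h1
    obtain ⟨s, hs⟩ := hθ1 x
    simp only [smul_eq_mul] at h1
    set α := (θ x).1
    set β := (θ x).2.1
    have hα : α = 2 * s + β := by linarith
    have h2 : s * (s + β) = 2 * (c - d) := by
      rw [hα] at h1
      linarith
    have h3 : Even (s * (s + β)) := by rw [h2]; exact even_two_mul _
    obtain h | h := Int.even_mul.mp h3 <;> obtain ⟨q, hq⟩ := h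
    · right; exact ⟨q, by linarith⟩
    · left; exact ⟨q, by linarith⟩
  -- up to the reflection in the second vector, `θ` takes values in the scaled copy of `U ⊕ N₂`
  obtain ⟨θ', hθ'form, hθ'⟩ : ∃ θ' : L₁ →ₗ[ℤ] ℤ × ℤ × N₂,
      (∀ x y, oddForm C₂ (θ' x) (θ' y) = 4 * B₁ x y) ∧
      ∀ x, θ' x ∈ LinearMap.range (doubleEmb N₂) := by
    obtain h | h := forall_four_dvd_or
      (f := LinearMap.fst ℤ _ _ ∘ₗ θ + LinearMap.fst ℤ _ _ ∘ₗ LinearMap.snd ℤ _ _ ∘ₗ θ)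
      (g := LinearMap.fst ℤ _ _ ∘ₗ θ - LinearMap.fst ℤ _ _ ∘ₗ LinearMap.snd ℤ _ _ ∘ₗ θ) hθ3
    · exact ⟨θ, hform, fun x => mem_range_doubleEmb (h x) (hθ2 x)⟩
    · let ρ : (ℤ × ℤ × N₂) →ₗ[ℤ] ℤ × ℤ × N₂ :=
        LinearMap.prodMap LinearMap.id (LinearMap.prodMap (-LinearMap.id) LinearMap.id)
      refine ⟨ρ ∘ₗ θ, fun x y => ?_, fun x => mem_range_doubleEmb ?_ (hθ2 x)⟩
      · rw [← hform, oddForm_apply, oddForm_apply]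
        simp [ρ]
      · simpa [ρ, sub_eq_add_neg] using h x
  let ψ : L₁ →ₗ[ℤ] L₂ := (E₂.symm : (ℤ × ℤ × N₂) →ₗ[ℤ] L₂) ∘ₗ
    ((LinearEquiv.ofInjective (doubleEmb N₂) injective_doubleEmb).symm :
      LinearMap.range (doubleEmb N₂) →ₗ[ℤ] ℤ × ℤ × N₂) ∘ₗ LinearMap.codRestrict _ θ' hθ'
  have hψ : ∀ x, doubleEmb N₂ (E₂ (ψ x)) = θ' x := fun x => by
    simp only [ψ, LinearMap.comp_apply, LinearEquiv.coe_coe, LinearEquiv.apply_symm_apply]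
    have := (LinearEquiv.ofInjective (doubleEmb N₂) injective_doubleEmb).apply_symm_apply
      ⟨θ' x, hθ' x⟩
    exact congrArg Subtype.val this
  refine equivalent_of_isometric_embedding hB₁ hB₂ hp₁ hp₂ (hr₁.trans hr₂.symm) ψ fun x y => ?_
  have h1 := hθ'form x y
  rw [← hψ, ← hψ, oddForm_doubleEmb, ← hE₂] at h1
  exact mul_left_cancel₀ four_ne_zero h1

/-! ### Lattices of signature `(1, n)` and `II_{1,17}` -/

theorem ScalesDual.of_dvd {L : Type*} [AddCommGroup L] {B : LinearMap.BilinForm ℤ L} {c d : ℤ}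
    (h : ScalesDual B c) (hcd : c ∣ d) : ScalesDual B d := fun φ => by
  obtain ⟨a, rfl⟩ := hcd
  obtain ⟨x, hx⟩ := h (a • φ)
  exact ⟨x, fun y => by rw [hx, LinearMap.smul_apply, smul_eq_mul, mul_assoc]⟩

end IntForm

open IntForm

namespace IntLattice

theorem scalesDual_disc (L : IntLattice.{u}) : ScalesDual L.form L.disc := by
  rw [L.disc_eq (Module.finBasis ℤ L.carrier)]
  exact scalesDual_det L.isSymm _

theorem IsUnimodular.scalesDual {L : IntLattice.{u}} (h : L.IsUnimodular) : ScalesDual L.form 1 :=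
  L.scalesDual_disc.of_dvd h.dvd

theorem eq_zero_of_form_eq_zero (L : IntLattice.{u}) {x : L.carrier} (h : L.form x = 0) : x = 0 :=
  L.nondegenerate.1 x fun y => by rw [h, LinearMap.zero_apply]

theorem realForm_apply (L : IntLattice.{u}) (x : TensorProduct ℤ ℝ L.carrier) :
    L.realForm x = LinearMap.BilinForm.baseChange ℝ L.form x x := rfl

theorem baseChange_isSymm (L : IntLattice.{u}) :
    (LinearMap.BilinForm.baseChange ℝ L.form).IsSymm := by
  refine ⟨fun x y => ?_⟩
  induction x with
  | zero => simp
  | add x₁ x₂ h₁ h₂ => simp [h₁, h₂]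
  | tmul a x =>
    induction y with
    | zero => simp
    | add y₁ y₂ h₁ h₂ => simp [h₁, h₂]
    | tmul b y =>
      rw [LinearMap.BilinForm.baseChange_tmul, LinearMap.BilinForm.baseChange_tmul,
        L.isSymm.eq x y, mul_comm a b]

theorem disc_ne_zero (L : IntLattice.{u}) : L.disc ≠ 0 :=
  (LinearMap.BilinForm.nondegenerate_iff_det_ne_zero _).mp L.nondegenerate

theorem radical_realForm (L : IntLattice.{u}) : L.realForm.radical = ⊥ := by
  let b := Module.Free.chooseBasis ℤ L.carrier
  let b' := Algebra.TensorProduct.basis ℝ b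
  have hnd : (LinearMap.BilinForm.baseChange ℝ L.form).Nondegenerate := by
    refine LinearMap.BilinForm.nondegenerate_of_det_ne_zero _ b' ?_
    have h1 : LinearMap.BilinForm.toMatrix b' (LinearMap.BilinForm.baseChange ℝ L.form) =
        (LinearMap.BilinForm.toMatrix b L.form).map (Int.castRingHom ℝ) := by
      ext i j
      simp [LinearMap.BilinForm.toMatrix_apply, b']
    rw [h1, ← RingHom.mapMatrix_apply, ← RingHom.map_det]
    simpa [L.disc_eq b] using L.disc_ne_zero
  refine (Submodule.eq_bot_iff _).mpr fun x hx => hnd.1 x fun y => ?_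
  have h1 := LinearMap.congr_fun hx.2 y
  rw [QuadraticMap.polarBilin_apply_apply, QuadraticMap.polar] at h1
  simp only [realForm_apply, map_add, LinearMap.add_apply, L.baseChange_isSymm.eq y x,
    LinearMap.zero_apply] at h1
  linarith

theorem HasSignature.finrank_eq {L : IntLattice.{u}} {p q : ℕ} (h : L.HasSignature p q) :
    Module.finrank ℤ L.carrier = p + q := by
  have h1 := QuadraticForm.sigPos_add_sigNeg_add_radical (Q := L.realForm)
  rw [radical_realForm, finrank_bot, h.1, h.2, Module.finrank_baseChange] at h1
  exact h1.symm

/-- An orthogonal family of maximal length diagonalizes the real form of a lattice. -/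
theorem sigPos_eq_ncard (L : IntLattice.{u}) {n : ℕ} (hrank : Module.finrank ℤ L.carrier = n)
    {h : Fin n → L.carrier} (hh : ∀ i j, i ≠ j → L.form (h i) (h j) = 0)
    (h0 : ∀ i, L.form (h i) (h i) ≠ 0) :
    sigPos L.realForm = {i | 0 < L.form (h i) (h i)}.ncard := by
  let BR := LinearMap.BilinForm.baseChange ℝ L.form
  let v : Fin n → TensorProduct ℤ ℝ L.carrier := fun i => TensorProduct.tmul ℤ 1 (h i)
  have hv : ∀ i j, BR (v i) (v j) = L.form (h i) (h j) := fun i j => by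
    simp [BR, v]
  have hli : LinearIndependent ℝ v := by
    rw [Fintype.linearIndependent_iff]
    intro c hc j
    have h1 := congrArg (fun y => BR y (v j)) hc
    simp only [map_sum, LinearMap.sum_apply, map_smul, LinearMap.smul_apply, smul_eq_mul, map_zero,
      LinearMap.zero_apply, hv] at h1
    rw [Finset.sum_eq_single j (fun i _ hij => by rw [hh i j hij, Int.cast_zero, mul_zero])
      (by simp)] at h1
    exact (mul_eq_zero.mp h1).resolve_right (Int.cast_ne_zero.mpr (h0 j))
  rcases Nat.eq_zero_or_pos n with rfl | hn
  · have h1 := sigPos_le_finrank (Q := L.realForm)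
    rw [Module.finrank_baseChange, hrank] at h1
    rw [Nat.le_zero.mp h1, eq_comm, Set.ncard_eq_zero]
    exact Set.eq_empty_of_isEmpty _
  have : Nonempty (Fin n) := ⟨⟨0, hn⟩⟩
  let b := basisOfLinearIndependentOfCardEqFinrank hli
    (by rw [Fintype.card_fin, Module.finrank_baseChange, hrank])
  have hb : ∀ i, b i = v i := fun i => by simp [b]
  have hortho : (QuadraticMap.associated (R := ℝ) L.realForm).IsOrthoᵢ b := by
    rw [realForm, QuadraticMap.associated_left_inverse ℝ L.baseChange_isSymm.eq]
    intro i j hij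
    change BR (b i) (b j) = 0
    rw [hb, hb, hv, hh i j hij, Int.cast_zero]
  have he : L.realForm.Equivalent
      (QuadraticMap.weightedSumSquares ℝ fun i => L.realForm (b i)) := by
    rw [← QuadraticMap.basisRepr_eq_of_iIsOrtho L.realForm b hortho]
    exact ⟨L.realForm.isometryEquivBasisRepr b⟩
  rw [QuadraticForm.sigPos_of_equiv_weightedSumSquares he]
  congr 1
  ext i
  have h1 : L.realForm (b i) = L.form (h i) (h i) := by
    rw [hb]
    exact hv i i
  simp [h1]

/-- A lattice of signature `(1, n)` with `n ≤ 17` and discriminant `± 4 ^ k` is rationally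
isometric to `⟨1⟩ ⊕ ⟨-1⟩ⁿ`. -/
theorem exists_lorentzian_frame (L : IntLattice.{u}) {n k : ℕ} (h18 : n + 1 ≤ 18)
    (hsig : L.HasSignature 1 n) (hdisc : L.disc.natAbs = 4 ^ k) :
    ∃ (K : ℕ) (h : Fin (n + 1) → L.carrier) (ε : Fin (n + 1) → ℤ), (∀ i, ε i = 1 ∨ ε i = -1) ∧
      (∀ i j, L.form (h i) (h j) = if i = j then ε i * 4 ^ K else 0) ∧
      ∃ i₀, ∀ i, ε i = 1 ↔ i = i₀ := by
  have hrank : Module.finrank ℤ L.carrier = n + 1 := by rw [hsig.finrank_eq, add_comm]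
  let b := Module.finBasisOfFinrankEq ℤ L.carrier hrank
  obtain ⟨K, h, ε, hε, hh⟩ := exists_orthogonal_frame h18 L.isSymm b (k := k)
    (by rw [← L.disc_eq b, hdisc])
  refine ⟨K, h, ε, hε, hh, ?_⟩
  have h4 : (0 : ℤ) < 4 ^ K := by positivity
  have h1 := L.sigPos_eq_ncard hrank (h := h) (fun i j hij => by rw [hh, if_neg hij])
    (fun i => by
      rw [hh, if_pos rfl]
      obtain h | h := hε i <;> rw [h] <;> simp)
  rw [hsig.1, eq_comm, Set.ncard_eq_one] at h1
  obtain ⟨i₀, hi₀⟩ := h1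
  refine ⟨i₀, fun i => ?_⟩
  have h2 : i ∈ {i | 0 < L.form (h i) (h i)} ↔ i = i₀ := by rw [hi₀]; rfl
  rw [← h2, Set.mem_ofPred_eq, hh, if_pos rfl]
  obtain h | h := hε i <;> rw [h] <;> simp [h4.le]

theorem isLorentzian_of_frame (L : IntLattice.{u}) {n K : ℕ}
    (hrank : Module.finrank ℤ L.carrier = n) {h : Fin n → L.carrier} {ε : Fin n → ℤ}
    (hε : ∀ i, ε i = 1 ∨ ε i = -1)
    (hh : ∀ i j, L.form (h i) (h j) = if i = j then ε i * 4 ^ K else 0) {i₀ : Fin n}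
    (hi₀ : ∀ i, ε i = 1 ↔ i = i₀) : IsLorentzian L.form := by
  have h4 : (0 : ℤ) < 4 ^ K := by positivity
  have hε₀ : ε i₀ = 1 := (hi₀ i₀).mpr rfl
  refine isLorentzian_of_pos L.isSymm (u := h i₀) (by rw [hh, if_pos rfl, hε₀, one_mul]; exact h4)
    fun y hy hy0 => ?_
  have h1 := mul_apply_eq_sum L.isSymm hrank hε h4.ne' hh y y
  have hterm : ∀ i, ε i * L.form y (h i) * L.form y (h i) = -(L.form y (h i) ^ 2) := fun i => by
    by_cases hi : i = i₀
    · rw [hi, L.isSymm.eq, hy]; simp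
    · rw [(hε i).resolve_left (mt (hi₀ i).mp hi)]; ring
  simp only [hterm, Finset.sum_neg_distrib] at h1
  have h2 : 0 ≤ ∑ i, L.form y (h i) ^ 2 := Finset.sum_nonneg fun i _ => sq_nonneg _
  rcases h2.eq_or_lt with h3 | h3
  · exfalso
    apply hy0
    have h5 := (Finset.sum_eq_zero_iff_of_nonneg fun i _ => sq_nonneg (L.form y (h i))).mp h3.symm
    refine L.eq_zero_of_form_eq_zero (apply_eq_zero_of_orthogonal hrank
      (fun i j hij => by rw [hh, if_neg hij]) (fun i => ?_)
      fun i => pow_eq_zero_iff two_ne_zero |>.mp (h5 i (Finset.mem_univ i)))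
    rw [hh, if_pos rfl]
    obtain h | h := hε i <;> rw [h] <;> simp
  · by_contra! hyy
    nlinarith [mul_nonneg h4.le hyy]

/-- The lattice `M` and its finite index sublattice `L` have the same rational space. -/
theorem IsOverlattice.exists_smul_eq {L : IntLattice.{u}} {M : IntLattice.{v}}
    {f : L.carrier →ₗ[ℤ] M.carrier} (h : L.IsOverlattice M f) :
    ∃ k : ℤ, 0 < k ∧ ∀ x, ∃ a, f a = k • x := by
  have := h.finite_quotient
  refine ⟨Nat.card (M.carrier ⧸ LinearMap.range f), by exact_mod_cast Nat.card_pos, fun x => ?_⟩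
  have h1 : Nat.card (M.carrier ⧸ LinearMap.range f) • (LinearMap.range f).mkQ x = 0 :=
    card_nsmul_eq_zero'
  rw [← map_nsmul, Submodule.mkQ_apply, Submodule.Quotient.mk_eq_zero] at h1
  obtain ⟨a, ha⟩ := h1
  exact ⟨a, by rw [ha, natCast_zsmul]⟩

theorem IsOverlattice.isLorentzian {L : IntLattice.{u}} {M : IntLattice.{v}}
    {f : L.carrier →ₗ[ℤ] M.carrier} (h : L.IsOverlattice M f) (hL : IsLorentzian L.form) :
    IsLorentzian M.form := by
  obtain ⟨k, hk, hf⟩ := h.exists_smul_eq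
  obtain ⟨u, hu⟩ := hL.1
  refine ⟨⟨f u, by rwa [h.map_form]⟩, fun x y hx hxy hy => ?_⟩
  obtain ⟨a, ha⟩ := hf x
  obtain ⟨b, hb⟩ := hf y
  have hkk : 0 < k * k := mul_pos hk hk
  have haa : L.form a a = k * k * M.form x x := by
    rw [← h.map_form, ha]; simp [mul_assoc]
  have hab : L.form a b = k * k * M.form x y := by
    rw [← h.map_form, ha, hb]; simp [mul_assoc]
  have hbb : L.form b b = k * k * M.form y y := by
    rw [← h.map_form, hb]; simp [mul_assoc]
  have h1 := hL.2 a b (by rw [haa]; exact mul_pos hkk hx) (by rw [hab, hxy, mul_zero]) (by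
    rintro rfl
    rw [map_zero, eq_comm, smul_eq_zero] at hb
    exact hy (hb.resolve_left hk.ne'))
  rw [hbb] at h1
  exact (pos_iff_neg_of_mul_neg h1).mp hkk

theorem IsOverlattice.finrank_eq {L : IntLattice.{u}} {M : IntLattice.{v}}
    {f : L.carrier →ₗ[ℤ] M.carrier} (h : L.IsOverlattice M f) :
    Module.finrank ℤ M.carrier = Module.finrank ℤ L.carrier := by
  have h1 := Submodule.finrank_quotient_add_finrank (LinearMap.range f)
  rw [LinearMap.finrank_range_of_inj h.injective] at h1
  have h2 : Module.finrank ℤ (M.carrier ⧸ LinearMap.range f) = 0 := by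
    rw [Module.finrank_eq_zero_iff_isTorsion]
    obtain ⟨k, hk, hf⟩ := h.exists_smul_eq
    intro x
    obtain ⟨x, rfl⟩ := (LinearMap.range f).mkQ_surjective x
    obtain ⟨a, ha⟩ := hf x
    refine ⟨⟨k, mem_nonZeroDivisors_of_ne_zero hk.ne'⟩, ?_⟩
    change k • (LinearMap.range f).mkQ x = 0
    rw [← map_smul, Submodule.mkQ_apply, Submodule.Quotient.mk_eq_zero]
    exact ⟨a, ha⟩
  omega

/-- The orthogonal frame identifies `L ⊗ ℚ` with the rational span of an even unimodular lattice of
type `Dₙ⁺`. If `N` is that lattice, then `L + (N ∩ L*)` is even and unimodular. -/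
theorem exists_overlattice (L : IntLattice.{u}) {n k : ℕ} (hL : L.IsEven)
    (hrank : Module.finrank ℤ L.carrier = n) (hdisc : L.disc.natAbs = 4 ^ k) {K : ℕ}
    {h : Fin n → L.carrier} {ε : Fin n → ℤ} (hε : ∀ i, ε i = 1 ∨ ε i = -1) (h8 : 8 ∣ ∑ i, ε i)
    (hh : ∀ i j, L.form (h i) (h j) = if i = j then ε i * 4 ^ K else 0) :
    ∃ (M : IntLattice.{u}) (f : L.carrier →ₗ[ℤ] M.carrier),
      L.IsOverlattice M f ∧ M.IsEven ∧ M.IsUnimodular := by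
  -- the frame is scaled so that its norms absorb the discriminant
  set H : ℤ := 2 ^ (K + 2 * k) with hH
  have h4 : ∀ m : ℕ, (4 : ℤ) ^ m = 2 ^ m * 2 ^ m := fun m => by rw [← mul_pow]; norm_num
  have hH0 : H ≠ 0 := by positivity
  have hh' : ∀ i j, L.form ((2 : ℤ) ^ (2 * k) • h i) ((2 : ℤ) ^ (2 * k) • h j) =
      if i = j then ε i * H ^ 2 else 0 := fun i j => by
    simp only [map_smul, LinearMap.smul_apply, smul_eq_mul, hh]
    split_ifs
    · rw [hH, h4, pow_add]; ring
    · simp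
  have hD : ScalesDual L.form (2 * H) := by
    refine L.scalesDual_disc.of_dvd ?_
    rw [← Int.natAbs_dvd, hdisc]
    refine ⟨2 * 2 ^ K, ?_⟩
    push_cast
    rw [hH, pow_add, pow_mul]
    norm_num
    ring
  obtain ⟨M, C, hC, hDM, heven, hp⟩ := exists_even_unimodular_overlattice L.isSymm
    (fun x => L.eq_zero_of_form_eq_zero) hL hrank hε h8 hH0 hh' hD
  set D : ℤ := 2 * H with hDdef
  have hD0 : D ≠ 0 := mul_ne_zero two_ne_zero hH0
  have hD2 : D ^ 2 ≠ 0 := pow_ne_zero 2 hD0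
  have hCsymm : C.IsSymm := ⟨fun x y => mul_left_cancel₀ hD2 (by rw [hC, hC, L.isSymm.eq])⟩
  have hCzero : ∀ x, C x = 0 → x = 0 := fun x hx => hp.eq_zero hCsymm one_ne_zero hx
  let M' : IntLattice.{u} :=
    { carrier := M
      form := C
      isSymm := hCsymm
      nondegenerate := ⟨fun x hx => hCzero x (LinearMap.ext hx), fun y hy =>
        hCzero y (LinearMap.ext fun x => by rw [hCsymm.eq, hy, LinearMap.zero_apply])⟩ }
  let f : L.carrier →ₗ[ℤ] M := LinearMap.codRestrict M (D • LinearMap.id) hDM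
  have hf : ∀ l, (f l : L.carrier) = D • l := fun l => rfl
  refine ⟨M', f, ⟨?_, ?_, ?_⟩, heven, ?_⟩
  · intro x y hxy
    exact smul_right_injective _ hD0 (congrArg Subtype.val hxy)
  · intro x y
    refine mul_left_cancel₀ hD2 ?_
    change D ^ 2 * C (f x) (f y) = _
    rw [hC, hf, hf]
    simp only [map_smul, LinearMap.smul_apply, smul_eq_mul]
    ring
  · change Finite (M ⧸ LinearMap.range f)
    refine Module.finite_of_fg_torsion _ fun x => ?_
    obtain ⟨x, rfl⟩ := (LinearMap.range f).mkQ_surjective x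
    refine ⟨⟨D, mem_nonZeroDivisors_of_ne_zero hD0⟩, ?_⟩
    change D • (LinearMap.range f).mkQ x = 0
    rw [← map_smul, Submodule.mkQ_apply, Submodule.Quotient.mk_eq_zero]
    exact ⟨x, Subtype.ext rfl⟩
  · change IsUnit M'.disc
    rw [M'.disc_eq (Module.finBasis ℤ M), Int.isUnit_iff_natAbs_eq]
    exact natAbs_det_eq_one hCsymm _ hp

theorem scalesDual_directSum {L : IntLattice.{u}} {M : IntLattice.{v}} {c : ℤ}
    (hL : ScalesDual L.form c) (hM : ScalesDual M.form c) :
    ScalesDual (L.directSum M).form c := fun φ => by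
  obtain ⟨x, hx⟩ := hL (φ ∘ₗ LinearMap.inl ℤ L.carrier M.carrier)
  obtain ⟨y, hy⟩ := hM (φ ∘ₗ LinearMap.inr ℤ L.carrier M.carrier)
  refine ⟨(x, y), fun z => ?_⟩
  have h1 : φ z = φ ((z.1, 0) + (0, z.2) : L.carrier × M.carrier) := by
    rw [Prod.mk_add_mk, add_zero, zero_add]
    rfl
  have h2 : φ z = φ (z.1, 0) + φ (0, z.2) := h1.trans (map_add φ _ _)
  change L.form x z.1 + M.form y z.2 = _
  rw [hx, hy, h2, mul_add]
  rfl

theorem disc_ofGram {n : ℕ} (A : Matrix (Fin n) (Fin n) ℤ) (hA : A.IsSymm) (hdet : A.det ≠ 0) :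
    (ofGram A hA hdet).disc = A.det := by
  rw [disc_eq _ (Pi.basisFun ℤ (Fin n))]
  change (LinearMap.BilinForm.toMatrix (Pi.basisFun ℤ (Fin n)) (Matrix.toBilin' A)).det = _
  rw [LinearMap.BilinForm.toMatrix_basisFun, LinearMap.BilinForm.toMatrix'_toBilin']

/-- The `E₈` form as a sum of squares: twice the coordinates, in the standard model of the root
system, of the combination of the simple roots with coefficients `x`. -/
theorem four_mul_E8_apply_self (x : Fin 8 → ℤ) :
    4 * Matrix.toBilin' (-CartanMatrix.E₈) x x = -((x 0 + 2 * x 1 - 2 * x 2) ^ 2 + (-x 0 + 2 * x 1 + 2 * x 2 - 2 * x 3) ^ 2 +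
      (-x 0 + 2 * x 3 - 2 * x 4) ^ 2 + (-x 0 + 2 * x 4 - 2 * x 5) ^ 2 +
      (-x 0 + 2 * x 5 - 2 * x 6) ^ 2 + (-x 0 + 2 * x 6 - 2 * x 7) ^ 2 + (-x 0 + 2 * x 7) ^ 2 +
      x 0 ^ 2) := by
  rw [Matrix.toBilin'_apply']
  simp [dotProduct, mulVec, Fin.sum_univ_eight, CartanMatrix.E₈]
  ring

theorem E8_apply_self_neg {x : Fin 8 → ℤ} (hx : x ≠ 0) :
    Matrix.toBilin' (-CartanMatrix.E₈) x x < 0 := by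
  by_contra! h
  have h1 := four_mul_E8_apply_self x
  apply hx
  have hsq : ∀ a : ℤ, a ^ 2 ≤ 0 → a = 0 := fun a ha =>
    pow_eq_zero_iff two_ne_zero |>.mp (le_antisymm ha (sq_nonneg a))
  have e0 := sq_nonneg (x 0 + 2 * x 1 - 2 * x 2)
  have e1 := sq_nonneg (-x 0 + 2 * x 1 + 2 * x 2 - 2 * x 3)
  have e2 := sq_nonneg (-x 0 + 2 * x 3 - 2 * x 4)
  have e3 := sq_nonneg (-x 0 + 2 * x 4 - 2 * x 5)
  have e4 := sq_nonneg (-x 0 + 2 * x 5 - 2 * x 6)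
  have e5 := sq_nonneg (-x 0 + 2 * x 6 - 2 * x 7)
  have e6 := sq_nonneg (-x 0 + 2 * x 7)
  have e7 := sq_nonneg (x 0)
  have f0 := hsq (x 0 + 2 * x 1 - 2 * x 2) (by linarith)
  have f1 := hsq (-x 0 + 2 * x 1 + 2 * x 2 - 2 * x 3) (by linarith)
  have f2 := hsq (-x 0 + 2 * x 3 - 2 * x 4) (by linarith)
  have f3 := hsq (-x 0 + 2 * x 4 - 2 * x 5) (by linarith)
  have f4 := hsq (-x 0 + 2 * x 5 - 2 * x 6) (by linarith)
  have f5 := hsq (-x 0 + 2 * x 6 - 2 * x 7) (by linarith)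
  have f6 := hsq (-x 0 + 2 * x 7) (by linarith)
  have f7 := hsq (x 0) (by linarith)
  clear * - f0 f1 f2 f3 f4 f5 f6 f7
  ext i
  fin_cases i <;> simp <;> omega

theorem E8_apply_self_nonpos (x : Fin 8 → ℤ) : Matrix.toBilin' (-CartanMatrix.E₈) x x ≤ 0 := by
  by_cases hx : x = 0
  · simp [hx]
  · exact (E8_apply_self_neg hx).le

theorem E8_apply_self_even (x : Fin 8 → ℤ) : Even (Matrix.toBilin' (-CartanMatrix.E₈) x x) := by
  rw [Matrix.toBilin'_apply']
  refine (Int.even_sub.mp (even_value_sub_sum_diag CartanMatrix.E₈_isSymm.neg x)).mpr ?_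
  refine Finset.even_sum _ fun i _ => Even.mul_left ?_ _
  fin_cases i <;> decide

theorem E8_isUnimodular : E8.IsUnimodular := by
  change IsUnit E8.disc
  rw [E8, disc_ofGram, det_neg, CartanMatrix.E₈_det]
  decide

theorem U_isUnimodular : U.IsUnimodular := by
  change IsUnit U.disc
  rw [U, disc_ofGram]
  decide

theorem II_form_apply (a b : Fin 2 → ℤ) (x y z w : Fin 8 → ℤ) :
    II_1_17.form (a, x, y) (b, z, w) = (a 0 * b 1 + a 1 * b 0) +
      (Matrix.toBilin' (-CartanMatrix.E₈) x z + Matrix.toBilin' (-CartanMatrix.E₈) y w) := by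
  have h : Matrix.toBilin' !![0, 1; 1, 0] a b = a 0 * b 1 + a 1 * b 0 := by
    rw [Matrix.toBilin'_apply']
    simp [dotProduct, mulVec, Fin.sum_univ_two]
  rw [← h]
  rfl

theorem II_isEven : II_1_17.IsEven := by
  rintro ⟨a, x, y⟩
  refine (II_form_apply a a x y x y).symm ▸ Even.add ?_
    ((E8_apply_self_even _).add (E8_apply_self_even _))
  rw [mul_comm]
  exact Even.add_self _

theorem II_scalesDual : ScalesDual II_1_17.form 1 :=
  scalesDual_directSum U_isUnimodular.scalesDual
    (scalesDual_directSum E8_isUnimodular.scalesDual E8_isUnimodular.scalesDual)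

theorem II_isLorentzian : IsLorentzian II_1_17.form := by
  have hneg : ∀ (a : Fin 2 → ℤ) (x y : Fin 8 → ℤ), a 1 = -a 0 → ¬(a 0 = 0 ∧ x = 0 ∧ y = 0) →
      (a 0 * a 1 + a 1 * a 0) + (Matrix.toBilin' (-CartanMatrix.E₈) x x +
        Matrix.toBilin' (-CartanMatrix.E₈) y y) < 0 := by
    intro a x y h1 hne
    have hx := E8_apply_self_nonpos x
    have hy := E8_apply_self_nonpos y
    rw [h1]
    by_cases ha : a 0 = 0
    · rw [ha]
      by_cases hx0 : x = 0
      · have := E8_apply_self_neg fun hy0 => hne ⟨ha, hx0, hy0⟩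
        linarith
      · have := E8_apply_self_neg hx0
        linarith
    · have : 0 < a 0 ^ 2 := by positivity
      nlinarith
  have horth : ∀ (a : Fin 2 → ℤ) (x y : Fin 8 → ℤ),
      ((![1, 1] : Fin 2 → ℤ) 0 * a 1 + (![1, 1] : Fin 2 → ℤ) 1 * a 0) +
        (Matrix.toBilin' (-CartanMatrix.E₈) 0 x + Matrix.toBilin' (-CartanMatrix.E₈) 0 y) = 0 →
      a 1 = -a 0 := by
    intro a x y h
    simp only [map_zero, LinearMap.zero_apply] at h
    simp at h
    linarith
  refine isLorentzian_of_pos II_1_17.isSymm (u := ((![1, 1] : Fin 2 → ℤ), 0, 0)) ?_ ?_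
  · refine lt_of_lt_of_eq ?_ (II_form_apply ![1, 1] ![1, 1] 0 0 0 0).symm
    simp
  · rintro ⟨a, x, y⟩ h hne
    have h1 := (II_form_apply ![1, 1] a 0 0 x y).symm.trans h
    have h2 := horth a x y h1
    refine lt_of_eq_of_lt (II_form_apply a a x y x y) (hneg a x y h2 ?_)
    rintro ⟨ha, rfl, rfl⟩
    refine hne (Prod.ext (funext fun i => ?_) rfl)
    fin_cases i
    · exact ha
    · exact h2.trans (by rw [ha]; rfl)

theorem II_finrank : Module.finrank ℤ II_1_17.carrier = 18 := by
  change Module.finrank ℤ ((Fin 2 → ℤ) × (Fin 8 → ℤ) × (Fin 8 → ℤ)) = 18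
  simp

end IntLattice

/-- Every even lattice `L` of signature `(1, 17)` and discriminant `-4 ^ i` has an even unimodular
overlattice, and every such overlattice is isometric to `II_{1,17} = U ⊕ E₈ ⊕ E₈`. -/
theorem mainTheorem9 (L : IntLattice.{u}) (i : ℕ) (hL : L.IsEven)
    (hsig : L.HasSignature 1 17) (hdisc : L.disc = -(4 : ℤ) ^ i) :
    (∃ (M : IntLattice.{u}) (f : L.carrier →ₗ[ℤ] M.carrier),
      L.IsOverlattice M f ∧ M.IsEven ∧ M.IsUnimodular) ∧
    (∀ (M : IntLattice.{v}) (f : L.carrier →ₗ[ℤ] M.carrier),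
      L.IsOverlattice M f → M.IsEven → M.IsUnimodular →
        M.Isometric IntLattice.II_1_17) := by
  have hdisc' : L.disc.natAbs = 4 ^ i := by
    rw [hdisc, Int.natAbs_neg, Int.natAbs_pow]
    rfl
  have hrank : Module.finrank ℤ L.carrier = 17 + 1 := hsig.finrank_eq
  obtain ⟨K, h, ε, hε, hh, i₀, hi₀⟩ := L.exists_lorentzian_frame le_rfl hsig hdisc'
  refine ⟨?_, fun M f hf hM hMu => ?_⟩
  · refine L.exists_overlattice hL hrank hdisc' hε ?_ hh
    have h1 : ∀ j, ε j = (if j = i₀ then 2 else 0) - 1 := fun j => by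
      split_ifs with hj
      · rw [(hi₀ j).mpr hj]; rfl
      · rw [(hε j).resolve_left (mt (hi₀ j).mp hj)]; rfl
    simp [h1]
  · have hlor := hf.isLorentzian (L.isLorentzian_of_frame hrank hε hh hi₀)
    exact equivalent_of_even_unimodular M.isSymm IntLattice.II_1_17.isSymm hMu.scalesDual
      IntLattice.II_scalesDual hlor IntLattice.II_isLorentzian hM IntLattice.II_isEven
      (n := 16) (hf.finrank_eq.trans hrank) IntLattice.II_finrank le_rfl
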